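/- Let $X$ be a complete separable metric space with Borel $\sigma$-algebra $\mathcal A$, let $\mu$ be a measure on $X$ which is boundedly finite (finite on bounded sets) with $\mu(X)=\infty$, and let $T$ be an invertible bimeasurable transformation of $X$ preserving $\mu$, such that $(X,\mathcal A,\mu,T)$ is conservative and ergodic. For a partition $\pi$ of $\{1,\dots,n\}$ and $\kappa=(k_1,\dots,k_n)\in\mathbb Z^n$, let $m_\pi^\kappa$ be the measure on $X^n$ defined by $$m_\pi^\kappa(A_1\times\cdots\times A_n)=\prod_{P\in\pi}\mu\Bigl(\bigcap_{i\in P}T^{-k_i}A_i\Bigr);$$ $\kappa$ is called $\pi$-compatible if $k_i=0$ whenever $i$ is the smallest element of its atom of $\pi$. Write $T^{\times n}=T\times\cdots\times T$ on $X^n$. Assume: (P1) for each $n\ge1$, the product system $(X^n,\mathcal A^{\otimes n},\mu^{\otimes n},T^{\times n})$ is ergodic; (P2) for each $n\ge 1$, every boundedly finite $T^{\times n}$-invariant measure $\sigma$ on $X^n$ whose marginals are absolutely continuous with respect to $\mu$ is conservative, and its ergodic components are (up to normalization) all of the form $m_\pi^\kappa$ for some partition $\pi$ of $\{1,\dots,n\}$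 and some $\pi$-compatible $\kappa$. Let $S$ be an invertible, ergodic, measure-preserving transformation of a probability space $(\Omega,\mathscr F,\mathbb P)$. Let $N$ be a $T$-point process on $(\Omega,\mathscr F,\mathbb P,S)$, that is, a random simple boundedly finite counting measure on $X$ such that, for every $A\in\mathcal A$, $N(A)\circ S=N(T^{-1}A)$ almost surely, and $N(A)=0$ almost surely if $\mu(A)=0$. Suppose that $N$ is $T$-free: for every integer $k\neq0$, almost surely $N$ and $N\circ S^k$ have no common point. Suppose also that $N$ has moments of all orders: $\mathbb E[N(A)^n]<\infty$ for all $n\ge1$ and all $A\in\mathcal A$ with $0<\mu(A)<\infty$. Then $N$ is a Poisson point process of intensity $\alpha\mu$ for some real $\alpha\ge0$: for all pairwise disjoint $A_1,\dots,A_k\in\mathcal A$ with $\alpha\mu(A_i)<\infty$, the random variables $N(A_1),\dots,N(A_k)$ are independent and Poisson distributed with parameters $\alpha\mu(A_1),\dots,\alpha\mu(A_k)$. (The case $\alpha=0$ is that of $N=0$ almost surely.) -/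

import Mathlib

open MeasureTheory ProbabilityTheory Set
open scoped NNReal ENNReal

noncomputable section

/-- A measure is boundedly finite if bounded sets have finite measure. -/
def BoundedlyFinite {Y : Type*} [PseudoMetricSpace Y] [MeasurableSpace Y] (ν : Measure Y) : Prop :=
  ∀ B : Set Y, Bornology.IsBounded B → ν B < ∞

/-- The diagonal map `T × ⋯ × T` on `Xⁿ`. -/
def diagonalMap {X : Type*} (n : ℕ) (T : X → X) : (Fin n → X) → (Fin n → X) :=
  fun x i => T (x i)

/-- The measure `m_π^κ` on `Xⁿ`: the image of the product measure `μ^{⊗π}` (one factor for each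
atom of the partition `π` of the index set) under the map sending `(y_P)_{P ∈ π}` to the point whose
`i`-th coordinate is `T^{κ i} y_P`, where `P` is the atom containing `i`.  Hence
`m_π^κ (A₁ × ⋯ × Aₙ) = ∏_{P ∈ π} μ (⋂_{i ∈ P} T^{-κ i} A_i)`. -/
def partitionMeasure {X : Type*} [MeasurableSpace X] (μ : Measure X) (T : X ≃ᵐ X) {n : ℕ}
    (π : Finpartition (Finset.univ : Finset (Fin n))) (κ : Fin n → ℤ) : Measure (Fin n → X) :=
  (Measure.pi fun _ : {P // P ∈ π.parts} => μ).map
    fun y i => ((T.toEquiv : Equiv.Perm X) ^ κ i) (y ⟨π.part i, π.part_mem.2 (Finset.mem_univ i)⟩)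

/-- `κ` is `π`-compatible if `κ i = 0` whenever `i` is the smallest element of its atom. -/
def PartitionCompatible {n : ℕ} (π : Finpartition (Finset.univ : Finset (Fin n)))
    (κ : Fin n → ℤ) : Prop :=
  ∀ i : Fin n, (∀ j ∈ π.part i, i ≤ j) → κ i = 0

/-- `ρ` is an ergodic decomposition of `σ` with respect to `R`: it is a `σ`-finite measure on the
space of measures, almost every `ν` (an ergodic component of `σ`) is a nonzero `σ`-finite
`R`-invariant ergodic measure, and `σ A = ∫ ν A dρ(ν)` for every measurable `A`. -/
structure IsErgodicDecomposition {Y : Type*} [MeasurableSpace Y] (R : Y → Y) (σ : Measure Y)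
    (ρ : Measure (Measure Y)) : Prop where
  sigmaFinite : SigmaFinite ρ
  component : ∀ᵐ ν ∂ρ, ν ≠ 0 ∧ SigmaFinite ν ∧ Ergodic R ν
  barycenter : ∀ A : Set Y, MeasurableSet A → σ A = ∫⁻ ν, ν A ∂ρ

/-- Property (P1): all the product systems `(Xⁿ, μ^{⊗n}, T × ⋯ × T)`, `n ≥ 1`, are ergodic. -/
def PropertyP1 {X : Type*} [MeasurableSpace X] (μ : Measure X) (T : X ≃ᵐ X) : Prop :=
  ∀ n : ℕ, 1 ≤ n → Ergodic (diagonalMap n T) (Measure.pi fun _ : Fin n => μ)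

/-- Property (P2): for `n ≥ 1`, every boundedly finite `T × ⋯ × T`-invariant measure on `Xⁿ` whose
marginals are absolutely continuous with respect to `μ` is conservative, and its ergodic components
(normalized by suitable multiplicative constants, which the decomposing measure absorbs) are all of
the form `m_π^κ` for a partition `π` and a `π`-compatible family `κ`. -/
def PropertyP2 {X : Type*} [PseudoMetricSpace X] [MeasurableSpace X] (μ : Measure X)
    (T : X ≃ᵐ X) : Prop :=
  ∀ n : ℕ, 1 ≤ n → ∀ σ : Measure (Fin n → X),
    BoundedlyFinite σ →
    MeasurePreserving (diagonalMap n T) σ σ →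
    (∀ i : Fin n, σ.map (fun x => x i) ≪ μ) →
    Conservative (diagonalMap n T) σ ∧
      ∃ ρ : Measure (Measure (Fin n → X)),
        IsErgodicDecomposition (diagonalMap n T) σ ρ ∧
        ∀ᵐ ν ∂ρ, ∃ (π : Finpartition (Finset.univ : Finset (Fin n))) (κ : Fin n → ℤ),
          PartitionCompatible π κ ∧ ν = partitionMeasure μ T π κ

/-- The set `X^*` of simple counting measures: boundedly finite sums of Dirac masses at the points
of a countable set. -/
def simpleCountingMeasures (X : Type*) [PseudoMetricSpace X] [MeasurableSpace X] :
    Set (Measure X) :=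
  {ξ | BoundedlyFinite ξ ∧
    ∃ s : Set X, s.Countable ∧ ξ = Measure.sum fun x : s => Measure.dirac (x : X)}

/-- A point process on `X`: a random element of `X^*`.  The `σ`-algebra on `X^*` is the trace of the
one on `Measure X` generated by the evaluations `ξ ↦ ξ A`, `A` measurable; on boundedly finite
measures it is already generated by the evaluations at bounded measurable sets. -/
structure IsPointProcess {X Ω : Type*} [PseudoMetricSpace X] [MeasurableSpace X]
    [MeasurableSpace Ω] (N : Ω → Measure X) : Prop where
  measurable : Measurable N
  mem_simple : ∀ ω, N ω ∈ simpleCountingMeasures X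

/-- `N` is a `T`-point process on the invertible probability preserving system `(Ω, P, S)`. -/
structure IsTPointProcess {X Ω : Type*} [PseudoMetricSpace X] [MeasurableSpace X]
    [MeasurableSpace Ω] (μ : Measure X) (T : X ≃ᵐ X) (P : Measure Ω) (S : Ω ≃ᵐ Ω)
    (N : Ω → Measure X) : Prop where
  pointProcess : IsPointProcess N
  null : ∀ A : Set X, MeasurableSet A → μ A = 0 → ∀ᵐ ω ∂P, N ω A = 0
  measurePreserving : MeasurePreserving S P P
  equivariant : ∀ A : Set X, MeasurableSet A → ∀ᵐ ω ∂P, N (S ω) A = N ω (T ⁻¹' A)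

/-- `N` is `T`-free: for `k ≠ 0`, almost surely `N` and `N ∘ S^k` have no common points (`x` is a
point of `N` if `N {x} = 1`). -/
def IsFreeProcess {X Ω : Type*} [MeasurableSpace X] [MeasurableSpace Ω] (P : Measure Ω)
    (S : Ω ≃ᵐ Ω) (N : Ω → Measure X) : Prop :=
  ∀ k : ℤ, k ≠ 0 → ∀ᵐ ω ∂P, ∀ x : X,
    ¬ (N ω {x} = 1 ∧ N (((S.toEquiv : Equiv.Perm Ω) ^ k) ω) {x} = 1)

/-- `N` has moments of all orders: `E[N(A)^n] < ∞` for all `n ≥ 1` and all measurable `A` with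
`0 < μ A < ∞`. -/
def HasAllMoments {X Ω : Type*} [MeasurableSpace X] [MeasurableSpace Ω] (μ : Measure X)
    (P : Measure Ω) (N : Ω → Measure X) : Prop :=
  ∀ n : ℕ, 1 ≤ n → ∀ A : Set X, MeasurableSet A → 0 < μ A → μ A < ∞ →
    ∫⁻ ω, (N ω A) ^ n ∂P < ∞

/-- `N` is a Poisson point process of intensity `ν`: a point process such that, for disjoint
measurable `A₁, …, A_k` of finite `ν`-measure, the variables `N(A₁), …, N(A_k)` are independent and
Poisson distributed with parameters `ν(A₁), …, ν(A_k)`. -/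
structure IsPoissonProcess {X Ω : Type*} [PseudoMetricSpace X] [MeasurableSpace X]
    [MeasurableSpace Ω] (ν : Measure X) (P : Measure Ω) (N : Ω → Measure X) : Prop where
  pointProcess : IsPointProcess N
  poisson : ∀ (k : ℕ) (A : Fin k → Set X), (∀ i, MeasurableSet (A i)) → (∀ i, ν (A i) < ∞) →
    Pairwise (fun i j => Disjoint (A i) (A j)) →
    iIndepFun (fun i ω => N ω (A i)) P ∧
      ∀ i, P.map (fun ω => N ω (A i)) =
        (poissonMeasure (ν (A i)).toNNReal).map (fun m : ℕ => (m : ℝ≥0∞))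

end

/-!
The moment measure of order `n` of `N`, with value `E[N(A₁) ⋯ N(Aₙ)]` on `A₁ × ⋯ × Aₙ`, is boundedly
finite, invariant under `T × ⋯ × T`, and has marginals absolutely continuous with respect to `μ`, so
that (P2) applies to it. Only one of the components `m_π^κ` charges the set of points whose
coordinates lie on distinct `T`-orbits, namely `μ^{⊗n}`; hence the moment measure is a multiple of
`μ^{⊗n}` there (`PropertyP2.mul_pi_eq`). By freeness, a tuple of distinct points of `N` almost
surely has its coordinates on distinct orbits, and since `μ` has no atoms the other tuples are
`μ^{⊗n}`-negligible. Integrating the number of injective families of points therefore gives, for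
disjoint sets `Aᵢ`,

  `E[∏ᵢ (N(Aᵢ))_{aᵢ}] = c (∑ᵢ aᵢ) ∏ᵢ μ(Aᵢ)^{aᵢ}`,

where `(x)_a` is the falling factorial (`exists_lintegral_prod_descFactorial`).

The constants are determined by the ergodicity of `S`. In the variance of
`N(A) / μ(A) - N(B) / μ(B)` the constant `c 2` cancels, and what is left is at most
`c 1 / μ(A) + c 1 / μ(B)`. As `μ` is infinite, the normalized counts along growing balls form a
Cauchy sequence in `L²` whose limit is `S`-invariant, hence a constant `α`; testing this limit
against `(N(B))_n` for a fixed ball `B` gives `c (n + 1) = α c n`, so `c n = αⁿ`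
(`HasFactorialMoments.exists_eq_pow`).

These are the factorial moments of independent Poisson variables of parameters `α μ(Aᵢ)`, and they
determine the joint law: `1_{K = m} = ∑_b (-1)^b / (m! b!) (K)_{m + b}`, and for such moments the
series may be integrated term by term (`map_eq_pi_poissonMeasure`).
-/

/-! ### Boundedly finite measures and nonatomicity -/

theorem measurable_perm_zpow {Y : Type*} [MeasurableSpace Y] (T : Y ≃ᵐ Y) (k : ℤ) :
    Measurable ⇑((T.toEquiv : Equiv.Perm Y) ^ k) := by
  induction k with
  | zero => simpa using measurable_id
  | succ n ih =>
    rw [zpow_add_one, Equiv.Perm.coe_mul]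
    exact ih.comp T.measurable
  | pred n ih =>
    rw [zpow_sub_one, Equiv.Perm.coe_mul]
    exact ih.comp T.symm.measurable

theorem BoundedlyFinite.sigmaFinite {Y : Type*} [PseudoMetricSpace Y] [MeasurableSpace Y]
    {ν : Measure Y} (h : BoundedlyFinite ν) : SigmaFinite ν := by
  rcases isEmpty_or_nonempty Y with hY | ⟨⟨x⟩⟩
  · rw [Measure.eq_zero_of_isEmpty ν]
    infer_instance
  · exact ⟨⟨⟨fun n => Metric.closedBall x n, fun _ => trivial,
      fun n => h _ Metric.isBounded_closedBall, Metric.iUnion_closedBall_nat x⟩⟩⟩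

/-- A second countable Borel space has a countable generating `π`-system that contains a countable
cover by bounded sets; two boundedly finite measures which agree on it are equal. -/
theorem exists_countable_isPiSystem_bounded (Y : Type*) [PseudoMetricSpace Y] [Nonempty Y]
    [SecondCountableTopology Y] [MeasurableSpace Y] [BorelSpace Y] :
    ∃ (C : Set (Set Y)) (B : ℕ → Set Y), C.Countable ∧ IsPiSystem C ∧
      ‹MeasurableSpace Y› = MeasurableSpace.generateFrom C ∧ (∀ i, B i ∈ C) ∧
      (∀ i, Bornology.IsBounded (B i)) ∧ ⋃ i, B i = univ := by
  obtain ⟨x⟩ := ‹Nonempty Y›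
  set b : Set (Set Y) :=
    TopologicalSpace.countableBasis Y ∪ range (fun n : ℕ => Metric.ball x n) with hb
  have hbo : ∀ s ∈ b, IsOpen s := by
    rintro s (hs | ⟨n, rfl⟩)
    · exact TopologicalSpace.isOpen_of_mem_countableBasis hs
    · exact Metric.isOpen_ball
  have hbc : b.Countable :=
    (TopologicalSpace.countable_countableBasis Y).union (countable_range _)
  have hsub : b ⊆ sInter '' {t | t.Finite ∧ t ⊆ b} := fun s hs =>
    ⟨{s}, ⟨finite_singleton s, singleton_subset_iff.2 hs⟩, sInter_singleton s⟩
  refine ⟨sInter '' {t | t.Finite ∧ t ⊆ b}, fun n => Metric.ball x n,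
    (countable_ofPred_finite_subset hbc).image _, ?_, ?_, fun n => hsub (Or.inr ⟨n, rfl⟩),
    fun n => Metric.isBounded_ball, Metric.iUnion_ball_nat x⟩
  · rintro _ ⟨s, ⟨hs, hsb⟩, rfl⟩ _ ⟨t, ⟨ht, htb⟩, rfl⟩ -
    exact ⟨s ∪ t, ⟨hs.union ht, union_subset hsb htb⟩, sInter_union s t⟩
  · apply le_antisymm
    · rw [BorelSpace.measurable_eq (α := Y),
        (TopologicalSpace.isBasis_countableBasis Y).borel_eq_generateFrom]
      exact MeasurableSpace.generateFrom_mono (subset_union_left.trans hsub)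
    · refine MeasurableSpace.generateFrom_le ?_
      rintro _ ⟨s, ⟨hs, hsb⟩, rfl⟩
      exact MeasurableSet.sInter hs.countable fun u hu => (hbo u (hsb hu)).measurableSet

/-- A conservative ergodic boundedly finite measure of infinite mass has no atoms: by
conservativity an atom would be a periodic point, and by ergodicity its finite orbit would carry the
whole mass. -/
theorem nullSingletonClass_of_conservative_ergodic {Y : Type*} [MetricSpace Y] [MeasurableSpace Y]
    [BorelSpace Y] {μ : Measure Y} {T : Y ≃ᵐ Y} (hb : BoundedlyFinite μ) (hinf : μ univ = ∞)
    (hc : Conservative T μ) (he : Ergodic T μ) : NullSingletonClass μ := by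
  classical
  refine ⟨fun x => ?_⟩
  by_contra hx
  obtain ⟨y, hy, m, hm, hmy⟩ := hc.exists_mem_iterate_mem' (measurableSet_singleton x) hx
  obtain rfl : y = x := hy
  have hper : T^[m] y = y := hmy
  set O : Finset Y := Finset.image (fun j => T^[j] y) (Finset.range m) with hO
  have hmem : ∀ z, z ∈ O ↔ ∃ j < m, T^[j] y = z := by simp [hO]
  have hTO : ∀ z ∈ O, T z ∈ O := by
    intro z hz
    obtain ⟨j, hj, rfl⟩ := (hmem z).1 hz
    rw [hmem]
    rcases Nat.lt_or_ge (j + 1) m with h | h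
    · exact ⟨j + 1, h, Function.iterate_succ_apply' _ _ _⟩
    · refine ⟨0, Nat.pos_of_ne_zero hm, ?_⟩
      rw [← Function.iterate_succ_apply' T j y, show j.succ = m by omega, hper]
      rfl
  -- `T` maps the finite set `O` into itself and is injective, hence permutes it
  have hpre : T ⁻¹' (O : Set Y) = O := by
    have himg : T '' (O : Set Y) = O := by
      have h1 : O.image T ⊆ O := fun z hz => by
        obtain ⟨w, hw, rfl⟩ := Finset.mem_image.1 hz
        exact hTO w hw
      have h2 := Finset.eq_of_subset_of_card_le h1
        (Finset.card_image_of_injective O T.injective).ge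
      rw [← Finset.coe_image, h2]
    conv_lhs => rw [← himg]
    exact preimage_image_eq _ T.injective
  have hyO : y ∈ O := (hmem y).2 ⟨0, Nat.pos_of_ne_zero hm, rfl⟩
  have hfin : μ (O : Set Y) < ∞ := hb _ O.finite_toSet.isBounded
  rcases he.toPreErgodic.ae_empty_or_univ O.measurableSet hpre with h | h
  · rw [ae_eq_empty] at h
    exact hx (measure_mono_null (singleton_subset_iff.2 hyO) h)
  · rw [measure_congr h, hinf] at hfin
    exact lt_irrefl _ hfin

/-! ### Equivariance of the process as a random measure -/

theorem IsPointProcess.boundedlyFinite {X Ω : Type*} [PseudoMetricSpace X] [MeasurableSpace X]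
    [MeasurableSpace Ω] {N : Ω → Measure X} (hN : IsPointProcess N) (ω : Ω) :
    BoundedlyFinite (N ω) :=
  (hN.mem_simple ω).1

theorem IsPointProcess.sigmaFinite {X Ω : Type*} [PseudoMetricSpace X] [MeasurableSpace X]
    [MeasurableSpace Ω] {N : Ω → Measure X} (hN : IsPointProcess N) (ω : Ω) : SigmaFinite (N ω) :=
  (hN.boundedlyFinite ω).sigmaFinite

section Equivariance

variable {X Ω : Type*} [MetricSpace X] [MeasurableSpace X] [BorelSpace X] [MeasurableSpace Ω]
  {μ : Measure X} {T : X ≃ᵐ X} {P : Measure Ω} {S : Ω ≃ᵐ Ω} {N : Ω → Measure X}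

/-- The exceptional null set in the equivariance of `N` can be chosen independently of the set at
which the measures are evaluated, since a countable `π`-system determines them. -/
theorem IsTPointProcess.ae_eq_map [Nonempty X] [SecondCountableTopology X]
    (hN : IsTPointProcess μ T P S N) : ∀ᵐ ω ∂P, N (S ω) = (N ω).map T := by
  obtain ⟨C, B, hC, hpi, hgen, hBC, hB, hU⟩ := exists_countable_isPiSystem_bounded X
  have hmeas : ∀ s ∈ C, MeasurableSet s := fun s hs => by
    rw [hgen]
    exact MeasurableSpace.measurableSet_generateFrom hs
  have h : ∀ᵐ ω ∂P, ∀ s ∈ C, N (S ω) s = N ω (T ⁻¹' s) :=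
    (ae_ball_iff hC).2 fun s hs => hN.equivariant s (hmeas s hs)
  filter_upwards [h] with ω hω
  refine Measure.ext_of_generateFrom_of_iUnion C B hgen hpi hU hBC
    (fun i => (hN.pointProcess.boundedlyFinite (S ω) _ (hB i)).ne) fun s hs => ?_
  rw [hω s hs, T.map_apply]

theorem IsTPointProcess.ae_eq_map_pow [Nonempty X] [SecondCountableTopology X]
    (hN : IsTPointProcess μ T P S N) (k : ℕ) :
    ∀ᵐ ω ∂P, N (((S.toEquiv : Equiv.Perm Ω) ^ (k : ℤ)) ω) =
      (N ω).map ⇑((T.toEquiv : Equiv.Perm X) ^ (k : ℤ)) := by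
  induction k with
  | zero =>
    refine Filter.Eventually.of_forall fun ω => ?_
    simp only [Nat.cast_zero, zpow_zero, Equiv.Perm.coe_one, id_eq]
    exact Measure.map_id.symm
  | succ k ih =>
    have h1 := hN.measurePreserving.quasiMeasurePreserving.ae ih
    filter_upwards [h1, hN.ae_eq_map] with ω h1 h2
    push_cast
    rw [zpow_add_one, zpow_add_one, Equiv.Perm.coe_mul, Equiv.Perm.coe_mul,
      Function.comp_apply]
    refine h1.trans ?_
    rw [h2, Measure.map_map (measurable_perm_zpow T _) T.measurable]
    rfl

/-- The points of a simple counting measure are its atoms, and each of them has mass one. -/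
theorem IsPointProcess.exists_points (hN : IsPointProcess N) (ω : Ω) :
    ∃ s : Set X, s.Countable ∧ N ω sᶜ = 0 ∧ ∀ x, N ω {x} = s.indicator 1 x := by
  obtain ⟨-, s, hs, h⟩ := hN.mem_simple ω
  have hx : ∀ A, MeasurableSet A → N ω A = ∑' x : s, A.indicator 1 (x : X) := fun A hA => by
    rw [h, Measure.sum_apply _ hA]
    exact tsum_congr fun x => Measure.dirac_apply' _ hA
  refine ⟨s, hs, ?_, fun x => ?_⟩
  · rw [hx _ hs.measurableSet.compl]
    simp
  · rw [hx _ (measurableSet_singleton x)]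
    by_cases hxs : x ∈ s
    · rw [tsum_eq_single ⟨x, hxs⟩]
      · simp [hxs]
      · rintro ⟨y, hy⟩ hne
        have : y ≠ x := fun h => hne (Subtype.ext h)
        simp [this]
    · rw [indicator_of_notMem hxs]
      refine ENNReal.tsum_eq_zero.2 fun y => ?_
      have : (y : X) ≠ x := fun h => hxs (h ▸ y.2)
      simp [this]

end Equivariance

/-! ### Moment measures -/

/-- Powers of a measurable family of boundedly finite measures form a measurable family. The
restrictions to the powers of a ball are finite, so that it is enough to test them on boxes. -/
theorem measurable_pi_of_boundedlyFinite {X Ω ι : Type*} [PseudoMetricSpace X] [Nonempty X]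
    [MeasurableSpace X] [OpensMeasurableSpace X] [MeasurableSpace Ω] [Fintype ι]
    {N : Ω → Measure X} (hN : Measurable N) (hb : ∀ ω, BoundedlyFinite (N ω)) :
    Measurable fun ω => Measure.pi fun _ : ι => N ω := by
  obtain ⟨x⟩ := ‹Nonempty X›
  have hσ : ∀ ω, SigmaFinite (N ω) := fun ω => (hb ω).sigmaFinite
  set B : ℕ → Set X := fun k => Metric.closedBall x k with hB
  have hBm : ∀ k, MeasurableSet (B k) := fun k => Metric.isClosed_closedBall.measurableSet
  have hmono : Monotone fun k => (univ.pi fun _ : ι => B k) := fun k l hkl =>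
    pi_mono fun i _ => Metric.closedBall_subset_closedBall (by exact_mod_cast hkl)
  have hU : ⋃ k, (univ.pi fun _ : ι => B k) = univ := by
    rw [iUnion_univ_pi_of_monotone fun i k l hkl =>
      Metric.closedBall_subset_closedBall (by exact_mod_cast hkl)]
    simp [Metric.iUnion_closedBall_nat]
  have key : ∀ k, Measurable fun ω => Measure.pi fun _ : ι => (N ω).restrict (B k) := by
    intro k
    have hf : ∀ ω, IsFiniteMeasure ((N ω).restrict (B k)) := fun ω =>
      ⟨by simpa using hb ω _ Metric.isBounded_closedBall⟩
    have hev : ∀ s : ι → Set X, (∀ i, MeasurableSet (s i)) →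
        Measurable fun ω => (Measure.pi fun _ : ι => (N ω).restrict (B k)) (univ.pi s) := by
      intro s hs
      simp_rw [Measure.pi_pi, Measure.restrict_apply (hs _)]
      exact Finset.measurable_prod _ fun i _ =>
        (Measure.measurable_coe ((hs i).inter (hBm k))).comp hN
    refine Measurable.measure_of_isPiSystem generateFrom_pi.symm isPiSystem_pi ?_ ?_
    · rintro _ ⟨s, hs, rfl⟩
      exact hev s fun i => hs i (mem_univ i)
    · simpa using hev (fun _ => univ) fun _ => MeasurableSet.univ
  refine Measure.measurable_of_measurable_coe _ fun s hs => ?_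
  have : (fun ω => (Measure.pi fun _ : ι => N ω) s) =
      fun ω => ⨆ k, (Measure.pi fun _ : ι => (N ω).restrict (B k)) s := by
    funext ω
    conv_lhs => rw [← inter_univ s, ← hU, inter_iUnion]
    rw [Monotone.measure_iUnion fun k l hkl => inter_subset_inter_right _ (hmono hkl)]
    refine iSup_congr fun k => ?_
    rw [← Measure.restrict_pi_pi, Measure.restrict_apply hs]
  rw [this]
  exact Measurable.iSup fun k => (Measure.measurable_coe hs).comp (key k)

/-- The moment measure of order `n` of a random measure `N`: the mean of the `n`-th power of `N`,
so that `A₁ × ⋯ × Aₙ` has mass `E[N(A₁) ⋯ N(Aₙ)]`. -/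
noncomputable def momentMeasure {X Ω : Type*} [MeasurableSpace X] [MeasurableSpace Ω]
    (P : Measure Ω) (N : Ω → Measure X) (n : ℕ) : Measure (Fin n → X) :=
  P.bind fun ω => Measure.pi fun _ : Fin n => N ω

/-- The set of points of `Xⁿ` whose coordinates lie on pairwise distinct `T`-orbits. -/
def orbitFreeSet {X : Type*} [MeasurableSpace X] (T : X ≃ᵐ X) (n : ℕ) : Set (Fin n → X) :=
  {x | ∀ i j, i ≠ j → ∀ k : ℤ, x j ≠ ((T.toEquiv : Equiv.Perm X) ^ k) (x i)}

theorem compl_orbitFreeSet {X : Type*} [MeasurableSpace X] (T : X ≃ᵐ X) (n : ℕ) :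
    (orbitFreeSet T n)ᶜ = ⋃ (i) (j) (_ : i ≠ j) (k : ℤ),
      {x : Fin n → X | x j = ((T.toEquiv : Equiv.Perm X) ^ k) (x i)} := by
  ext x
  simp [orbitFreeSet]

section MomentMeasure

variable {X Ω : Type*} [MetricSpace X] [MeasurableSpace X] [BorelSpace X] [MeasurableSpace Ω]
  {μ : Measure X} {T : X ≃ᵐ X} {P : Measure Ω} {S : Ω ≃ᵐ Ω} {N : Ω → Measure X}

theorem IsPointProcess.measurable_pi [Nonempty X] (hN : IsPointProcess N) (n : ℕ) :
    Measurable fun ω => Measure.pi fun _ : Fin n => N ω :=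
  measurable_pi_of_boundedlyFinite hN.measurable hN.boundedlyFinite

theorem momentMeasure_apply [Nonempty X] (hN : IsPointProcess N) {n : ℕ} {A : Set (Fin n → X)}
    (hA : MeasurableSet A) :
    momentMeasure P N n A = ∫⁻ ω, (Measure.pi fun _ : Fin n => N ω) A ∂P :=
  Measure.bind_apply hA (hN.measurable_pi n).aemeasurable

theorem boundedlyFinite_momentMeasure [Nonempty X] (hN : IsTPointProcess μ T P S N)
    (hμ : BoundedlyFinite μ) (hmom : HasAllMoments μ P N) {n : ℕ} (hn : 1 ≤ n) :
    BoundedlyFinite (momentMeasure P N n) := by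
  obtain ⟨x⟩ := ‹Nonempty X›
  have := hN.pointProcess.sigmaFinite
  intro B hB
  obtain ⟨r, hr⟩ := hB.subset_closedBall (fun _ : Fin n => x)
  have hsub : B ⊆ univ.pi fun _ : Fin n => Metric.closedBall x (max r 0) := fun y hy i _ =>
    (dist_le_pi_dist y (fun _ => x) i).trans
      ((Metric.mem_closedBall.1 (hr hy)).trans (le_max_left _ _))
  have hm : MeasurableSet (Metric.closedBall x (max r 0)) :=
    Metric.isClosed_closedBall.measurableSet
  refine (measure_mono hsub).trans_lt ?_
  rw [momentMeasure_apply hN.pointProcess (MeasurableSet.univ_pi fun _ => hm)]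
  simp only [Measure.pi_pi, Finset.prod_const, Finset.card_univ, Fintype.card_fin]
  rcases eq_or_ne (μ (Metric.closedBall x (max r 0))) 0 with h0 | h0
  · have : ∀ᵐ ω ∂P, N ω (Metric.closedBall x (max r 0)) ^ n = 0 := by
      filter_upwards [hN.null _ hm h0] with ω hω
      rw [hω, zero_pow (by omega)]
    rw [lintegral_congr_ae this]
    simp
  · exact hmom n hn _ hm (pos_iff_ne_zero.2 h0) (hμ _ Metric.isBounded_closedBall)

theorem measurePreserving_momentMeasure [Nonempty X] [SecondCountableTopology X]
    (hN : IsTPointProcess μ T P S N) (n : ℕ) :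
    MeasurePreserving (diagonalMap n T) (momentMeasure P N n) (momentMeasure P N n) := by
  have hd : Measurable (diagonalMap n T) :=
    measurable_pi_lambda _ fun i => T.measurable.comp (measurable_pi_apply i)
  refine ⟨hd, Measure.ext fun A hA => ?_⟩
  have := hN.pointProcess.sigmaFinite
  rw [Measure.map_apply hd hA, momentMeasure_apply hN.pointProcess (hd hA),
    momentMeasure_apply hN.pointProcess hA]
  have hF : Measurable fun ω => (Measure.pi fun _ : Fin n => N ω) A :=
    (Measure.measurable_coe hA).comp (hN.pointProcess.measurable_pi n)
  rw [← hN.measurePreserving.lintegral_comp hF]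
  refine lintegral_congr_ae ?_
  filter_upwards [hN.ae_eq_map] with ω hω
  have hσ : SigmaFinite ((N ω).map T) := T.sigmaFinite_map
  rw [hω, ← Measure.pi_map_pi (fun _ => T.measurable.aemeasurable), ← Measure.map_apply hd hA]
  rfl

theorem map_eval_momentMeasure_absolutelyContinuous [Nonempty X] (hN : IsTPointProcess μ T P S N)
    {n : ℕ} (i : Fin n) : (momentMeasure P N n).map (fun x => x i) ≪ μ := by
  refine Measure.AbsolutelyContinuous.mk fun A hA h0 => ?_
  have := hN.pointProcess.sigmaFinite
  rw [Measure.map_apply (measurable_pi_apply i) hA,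
    momentMeasure_apply hN.pointProcess (measurable_pi_apply i hA)]
  have : ∀ᵐ ω ∂P, (Measure.pi fun _ : Fin n => N ω) ((fun x => x i) ⁻¹' A) = 0 := by
    filter_upwards [hN.null A hA h0] with ω hω
    exact (Measure.quasiMeasurePreserving_eval (fun _ : Fin n => N ω) i).preimage_null hω
  rw [lintegral_congr_ae this]
  simp

theorem measurableSet_eq_zpow [SecondCountableTopology X] (T : X ≃ᵐ X) {n : ℕ} (i j : Fin n)
    (k : ℤ) : MeasurableSet {x : Fin n → X | x j = ((T.toEquiv : Equiv.Perm X) ^ k) (x i)} :=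
  measurableSet_eq_fun (measurable_pi_apply j)
    ((measurable_perm_zpow T k).comp (measurable_pi_apply i))

theorem measurableSet_orbitFreeSet [SecondCountableTopology X] (T : X ≃ᵐ X) (n : ℕ) :
    MeasurableSet (orbitFreeSet T n) := by
  rw [← MeasurableSet.compl_iff, compl_orbitFreeSet]
  exact MeasurableSet.iUnion fun i => MeasurableSet.iUnion fun j => MeasurableSet.iUnion fun _ =>
    MeasurableSet.iUnion fun k => measurableSet_eq_zpow T i j k

/-- Given the other coordinates, one translate of one of them is a single point, hence negligible
for a measure without atoms. -/
theorem pi_compl_orbitFreeSet [SecondCountableTopology X] [SigmaFinite μ] [NullSingletonClass μ]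
    (T : X ≃ᵐ X) (n : ℕ) : (Measure.pi fun _ : Fin n => μ) (orbitFreeSet T n)ᶜ = 0 := by
  rw [compl_orbitFreeSet]
  simp only [measure_iUnion_null_iff]
  intro i j hij k
  obtain _ | n := n
  · exact i.elim0
  obtain ⟨l, rfl⟩ := Fin.exists_succAbove_eq hij
  have hmp := measurePreserving_piFinSuccAbove (fun _ : Fin (n + 1) => μ) j
  set E : Set (X × (Fin n → X)) := {p | p.1 = ((T.toEquiv : Equiv.Perm X) ^ k) (p.2 l)} with hE
  have hEm : MeasurableSet E := measurableSet_eq_fun measurable_fst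
    ((measurable_perm_zpow T k).comp ((measurable_pi_apply l).comp measurable_snd))
  have : {x : Fin (n + 1) → X | x j = ((T.toEquiv : Equiv.Perm X) ^ k) (x (j.succAbove l))} =
      MeasurableEquiv.piFinSuccAbove (fun _ => X) j ⁻¹' E := rfl
  rw [this, hmp.measure_preimage hEm.nullMeasurableSet,
    Measure.prod_apply_symm hEm]
  have : ∀ z : Fin n → X, (fun y => (y, z)) ⁻¹' E = {((T.toEquiv : Equiv.Perm X) ^ k) (z l)} :=
    fun z => rfl
  simp [this]

end MomentMeasure

/-! ### Consequences of (P2) and of freeness -/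

/-- If two distinct indices lie in the same atom, the corresponding coordinates of `m_π^κ`-almost
every point lie on the same orbit; otherwise all atoms are singletons, `κ` vanishes, and
`m_π^κ` is the product measure. -/
theorem partitionMeasure_eq_pi_or_orbitFreeSet_eq_zero {X : Type*} [MetricSpace X]
    [MeasurableSpace X] [BorelSpace X] [SecondCountableTopology X] (μ : Measure X) [SigmaFinite μ]
    (T : X ≃ᵐ X) {n : ℕ}
    {π : Finpartition (Finset.univ : Finset (Fin n))} {κ : Fin n → ℤ}
    (hκ : PartitionCompatible π κ) :
    partitionMeasure μ T π κ = Measure.pi (fun _ => μ) ∨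
      partitionMeasure μ T π κ (orbitFreeSet T n) = 0 := by
  have hm : Measurable fun (y : {P // P ∈ π.parts} → X) (i : Fin n) =>
      ((T.toEquiv : Equiv.Perm X) ^ κ i) (y ⟨π.part i, π.part_mem.2 (Finset.mem_univ i)⟩) :=
    measurable_pi_lambda _ fun i => (measurable_perm_zpow T _).comp (measurable_pi_apply _)
  by_cases hd : ∃ i j, i ≠ j ∧ π.part i = π.part j
  · right
    obtain ⟨i, j, hij, hp⟩ := hd
    rw [partitionMeasure, Measure.map_apply hm (measurableSet_orbitFreeSet T n)]
    convert measure_empty (μ := Measure.pi fun _ : {P // P ∈ π.parts} => μ)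
    refine eq_empty_of_forall_notMem fun y hy => hy i j hij (κ j - κ i) ?_
    simp only [← Equiv.Perm.mul_apply, ← zpow_add, sub_add_cancel, hp]
  · left
    push Not at hd
    have hinj : ∀ i j, π.part i = π.part j → i = j := fun i j h => by
      by_contra hij
      exact hd i j hij h
    have hκ0 : ∀ i, κ i = 0 := fun i => hκ i fun j hj => by
      have h1 := (π.mem_part_iff_part_eq_part (Finset.mem_univ j) (Finset.mem_univ i)).1 hj
      exact (hinj _ _ h1).ge
    let e : Fin n ≃ {P // P ∈ π.parts} := Equiv.ofBijective
      (fun i => ⟨π.part i, π.part_mem.2 (Finset.mem_univ i)⟩)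
      ⟨fun i j h => hinj i j (congrArg Subtype.val h), fun ⟨p, hp⟩ => by
        obtain ⟨i, hi⟩ := π.nonempty_of_mem_parts hp
        exact ⟨i, Subtype.ext (π.part_eq_of_mem hp hi)⟩⟩
    symm
    refine Measure.pi_eq fun s hs => ?_
    rw [partitionMeasure, Measure.map_apply hm (MeasurableSet.univ_pi hs)]
    have : (fun (y : {P // P ∈ π.parts} → X) (i : Fin n) => ((T.toEquiv : Equiv.Perm X) ^ κ i)
        (y ⟨π.part i, π.part_mem.2 (Finset.mem_univ i)⟩)) ⁻¹' univ.pi s =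
        univ.pi fun p => s (e.symm p) := by
      ext y
      simp only [hκ0, zpow_zero, Equiv.Perm.coe_one, id_eq, mem_preimage, mem_pi, mem_univ,
        true_implies]
      refine ⟨fun h p => ?_, fun h i => ?_⟩
      · have h1 : y (e (e.symm p)) ∈ s (e.symm p) := h (e.symm p)
        rwa [e.apply_symm_apply] at h1
      · have h1 : y (e i) ∈ s (e.symm (e i)) := h (e i)
        rwa [e.symm_apply_apply] at h1
    rw [this, Measure.pi_pi]
    exact Fintype.prod_equiv e.symm _ _ fun _ => rfl

/-- On the set of points with coordinates on distinct orbits, the ergodic components allowed by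
(P2) are multiples of the product measure, hence so is the measure they compose. -/
theorem PropertyP2.mul_pi_eq {X : Type*} [MetricSpace X] [MeasurableSpace X] [BorelSpace X]
    [SecondCountableTopology X] {μ : Measure X} [SigmaFinite μ] {T : X ≃ᵐ X}
    (hP2 : PropertyP2 μ T) {n : ℕ} (hn : 1 ≤ n) {σ : Measure (Fin n → X)} (hσ : BoundedlyFinite σ)
    (hT : MeasurePreserving (diagonalMap n T) σ σ) (hac : ∀ i, σ.map (fun x => x i) ≪ μ)
    {A Q : Set (Fin n → X)} (hA : MeasurableSet A) (hQ : MeasurableSet Q)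
    (hAT : A ⊆ orbitFreeSet T n) (hQT : Q ⊆ orbitFreeSet T n) :
    σ A * Measure.pi (fun _ => μ) Q = σ Q * Measure.pi (fun _ => μ) A := by
  obtain ⟨-, ρ, hρ, hform⟩ := hP2 n hn σ hσ hT hac
  rw [hρ.barycenter A hA, hρ.barycenter Q hQ,
    ← lintegral_mul_const _ (Measure.measurable_coe hA),
    ← lintegral_mul_const _ (Measure.measurable_coe hQ)]
  refine lintegral_congr_ae ?_
  filter_upwards [hform] with ν ⟨π, κ, hκ, hν⟩
  rcases partitionMeasure_eq_pi_or_orbitFreeSet_eq_zero μ T hκ with h | h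
  · rw [hν, h, mul_comm]
  · rw [hν, measure_mono_null hAT h, measure_mono_null hQT h, zero_mul, zero_mul]

theorem measurableSet_injective {X : Type*} [MetricSpace X] [MeasurableSpace X] [BorelSpace X]
    [SecondCountableTopology X] (n : ℕ) : MeasurableSet {x : Fin n → X | Function.Injective x} := by
  have : {x : Fin n → X | Function.Injective x} = ⋂ (i) (j) (_ : i ≠ j), {x | x i = x j}ᶜ := by
    ext x
    simp only [mem_ofPred_eq, mem_iInter, mem_compl_iff, Function.Injective]
    exact forall₂_congr fun i j => not_imp_not.symm
  rw [this]
  exact MeasurableSet.iInter fun i => MeasurableSet.iInter fun j => MeasurableSet.iInter fun _ =>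
    (measurableSet_eq_fun (measurable_pi_apply i) (measurable_pi_apply j)).compl

theorem orbitFreeSet_subset_injective {X : Type*} [MeasurableSpace X] (T : X ≃ᵐ X) (n : ℕ) :
    orbitFreeSet T n ⊆ {x | Function.Injective x} := fun x hx i j hij => by
  by_contra hne
  exact hx i j hne 0 (by simpa using hij.symm)

section Free

variable {X Ω : Type*} [MetricSpace X] [MeasurableSpace X] [BorelSpace X]
  [SecondCountableTopology X] [Nonempty X] [MeasurableSpace Ω]
  {μ : Measure X} {T : X ≃ᵐ X} {P : Measure Ω} {S : Ω ≃ᵐ Ω} {N : Ω → Measure X}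

/-- By freeness, two points of the process never differ by a nonzero power of `T`. -/
theorem ae_forall_points_of_free (hN : IsTPointProcess μ T P S N) (hfree : IsFreeProcess P S N) :
    ∀ᵐ ω ∂P, ∀ k : ℤ, k ≠ 0 → ∀ x y : X, N ω {x} = 1 → N ω {y} = 1 →
      y ≠ ((T.toEquiv : Equiv.Perm X) ^ k) x := by
  have hpos : ∀ᵐ ω ∂P, ∀ k : ℕ, k ≠ 0 → ∀ x y : X, N ω {x} = 1 → N ω {y} = 1 →
      y ≠ ((T.toEquiv : Equiv.Perm X) ^ (k : ℤ)) x := by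
    refine ae_all_iff.2 fun k => ?_
    rcases eq_or_ne k 0 with rfl | hk
    · simp
    filter_upwards [hfree k (by exact_mod_cast hk), hN.ae_eq_map_pow k] with ω h1 h2 _ x y hx hy hxy
    refine h1 y ⟨hy, ?_⟩
    rw [h2, Measure.map_apply (measurable_perm_zpow T k) (measurableSet_singleton y), ← hx]
    congr 1
    ext z
    simp [hxy]
  filter_upwards [hpos] with ω h k hk x y hx hy hxy
  rcases Int.lt_or_lt_of_ne hk with hneg | hk'
  · refine h k.natAbs (by omega) y x hy hx ?_
    rw [hxy, show ((k.natAbs : ℕ) : ℤ) = -k by omega, zpow_neg, ← Equiv.Perm.mul_apply,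
      inv_mul_cancel, Equiv.Perm.one_apply]
  · refine h k.natAbs (by omega) x y hx hy ?_
    rwa [show ((k.natAbs : ℕ) : ℤ) = k by omega]

/-- For a `T`-free process, almost every point with distinct coordinates for the moment measure has
its coordinates on distinct orbits. -/
theorem momentMeasure_injective_diff_orbitFreeSet (hN : IsTPointProcess μ T P S N)
    (hfree : IsFreeProcess P S N) (n : ℕ) :
    momentMeasure P N n ({x | Function.Injective x} \ orbitFreeSet T n) = 0 := by
  rw [momentMeasure_apply hN.pointProcess
    ((measurableSet_injective n).diff (measurableSet_orbitFreeSet T n))]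
  have := hN.pointProcess.sigmaFinite
  rw [lintegral_congr_ae (g := 0)]
  · simp
  filter_upwards [ae_forall_points_of_free hN hfree] with ω hω
  obtain ⟨s, -, hs0, hs1⟩ := hN.pointProcess.exists_points ω
  have hae : ∀ᵐ x ∂(Measure.pi fun _ : Fin n => N ω), ∀ i, x i ∈ s :=
    ae_all_iff.2 fun i => (Measure.quasiMeasurePreserving_eval (fun _ : Fin n => N ω) i).ae
      (show ∀ᵐ y ∂(N ω), y ∈ s from hs0)
  refine measure_mono_null ?_ hae
  rintro x ⟨hx, hxT⟩ hxs
  refine hxT fun i j hij k => ?_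
  have h1 : ∀ i, N ω {x i} = 1 := fun i => by rw [hs1, indicator_of_mem (hxs i), Pi.one_apply]
  rcases eq_or_ne k 0 with rfl | hk
  · simpa using fun h => hij (hx h).symm
  · exact hω k hk _ _ (h1 i) (h1 j)

end Free

/-! ### Counting points: factorial moments -/

theorem measure_eq_encard_of_singleton_eq_one {Y : Type*} [MeasurableSpace Y]
    [MeasurableSingletonClass Y] {ν : Measure Y} {C : Set Y} (hC : C.Countable)
    (h1 : ∀ x ∈ C, ν {x} = 1) : ν C = C.encard := by
  rw [← ENNReal.tsum_set_one, ← biUnion_of_singleton C, measure_biUnion hC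
    (fun x _ y _ hxy => disjoint_singleton.2 hxy) fun x _ => measurableSet_singleton x,
    biUnion_of_singleton]
  exact tsum_congr fun x => h1 x x.2

/-- Injective families with prescribed numbers `a i` of members in disjoint sets `F i` correspond
to families of injections `Fin (a i) ↪ F i`. -/
def injectiveFamilyEquiv {Y ι J : Type*} {a : ι → ℕ} (e : J ≃ Σ i, Fin (a i)) {F : ι → Set Y}
    (hF : Pairwise fun i j => Disjoint (F i) (F j)) :
    {x : J → Y // Function.Injective x ∧ ∀ j, x j ∈ F (e j).1} ≃ ∀ i, (Fin (a i) ↪ F i) where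
  toFun x i := ⟨fun t => ⟨x.1 (e.symm ⟨i, t⟩), by simpa using x.2.2 (e.symm ⟨i, t⟩)⟩,
    fun t u h => by
      have := e.symm.injective (x.2.1 (congrArg Subtype.val h))
      simpa using this⟩
  invFun g := ⟨fun j => g (e j).1 (e j).2, by
    refine ⟨fun j l h => ?_, fun j => (g _ _).2⟩
    have key : ∀ p q : Σ i, Fin (a i), (g p.1 p.2 : Y) = g q.1 q.2 → p = q := by
      rintro ⟨i, t⟩ ⟨i', t'⟩ h
      obtain rfl : i = i' := by
        by_contra hne
        refine disjoint_left.1 (hF hne) (g i t).2 ?_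
        change (g i t : Y) = g i' t' at h
        rw [h]
        exact (g i' t').2
      exact congrArg _ ((g i).injective (Subtype.ext h))
    exact e.injective (key _ _ h)⟩
  left_inv x := by
    ext j
    exact congrArg x.1 (e.symm_apply_apply j)
  right_inv g := by
    ext i t
    have h : e (e.symm ⟨i, t⟩) = ⟨i, t⟩ := e.apply_symm_apply _
    change ((g (e (e.symm ⟨i, t⟩)).1 (e (e.symm ⟨i, t⟩)).2 : F _) : Y) = g i t
    rw [h]

theorem encard_injectiveFamily {Y ι J : Type*} [Fintype ι] [Fintype J] {a : ι → ℕ}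
    (e : J ≃ Σ i, Fin (a i)) {F : ι → Set Y}
    (hF : Pairwise fun i j => Disjoint (F i) (F j)) (hfin : ∀ i, (F i).Finite) :
    {x : J → Y | Function.Injective x ∧ ∀ j, x j ∈ F (e j).1}.encard =
      ((∏ i, (F i).ncard.descFactorial (a i) : ℕ) : ℕ∞) := by
  classical
  have := fun i => (hfin i).fintype
  rw [← ENat.card_coe_set_eq]
  refine (ENat.card_congr (injectiveFamilyEquiv e hF)).trans ?_
  rw [ENat.card_eq_coe_natCard, Nat.card_pi]
  simp only [Nat.card_eq_fintype_card, Fintype.card_embedding_eq, Fintype.card_fin,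
    ← Nat.card_coe_set_eq]

/-- The number of points of the random measure `N` in `A`, as a natural number; it is meaningful
where `N A` is finite, and zero elsewhere. -/
noncomputable def pointCount {X Ω : Type*} [MeasurableSpace X] (N : Ω → Measure X) (A : Set X)
    (ω : Ω) : ℕ := ⌊(N ω A).toReal⌋₊

theorem measurable_pointCount {X Ω : Type*} [MeasurableSpace X] [MeasurableSpace Ω]
    {N : Ω → Measure X} (hN : Measurable N) {A : Set X} (hA : MeasurableSet A) :
    Measurable (pointCount N A) :=
  Nat.measurable_floor.comp ((Measure.measurable_coe hA).comp hN).ennreal_toReal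

/-- For disjoint sets of finite measure, the joint factorial moments of the numbers of points are
the products of powers of the measures, up to a constant `c n` depending only on the total order
`n`. -/
def HasFactorialMoments {X Ω : Type*} [MeasurableSpace X] [MeasurableSpace Ω] (μ : Measure X)
    (P : Measure Ω) (N : Ω → Measure X) (c : ℕ → ℝ≥0) : Prop :=
  ∀ (ι : Type) [Fintype ι] (a : ι → ℕ) (A : ι → Set X),
    (∀ i, MeasurableSet (A i)) → (∀ i, μ (A i) < ∞) →
    Pairwise (fun i j => Disjoint (A i) (A j)) →
    ∫⁻ ω, ∏ i, ((pointCount N (A i) ω).descFactorial (a i) : ℝ≥0∞) ∂P =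
      c (∑ i, a i) * ∏ i, μ (A i) ^ a i

section Count

variable {X Ω : Type*} [MetricSpace X] [MeasurableSpace X] [BorelSpace X] [MeasurableSpace Ω]
  {N : Ω → Measure X}

theorem IsPointProcess.exists_points_count (hN : IsPointProcess N) (ω : Ω) :
    ∃ s : Set X, s.Countable ∧ N ω sᶜ = 0 ∧ (∀ x ∈ s, N ω {x} = 1) ∧
      ∀ A, N ω A < ∞ → (s ∩ A).Finite ∧ pointCount N A ω = (s ∩ A).ncard ∧
        N ω A = pointCount N A ω := by
  obtain ⟨s, hs, hs0, hs1⟩ := hN.exists_points ω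
  have h1 : ∀ x ∈ s, N ω {x} = 1 := fun x hx => by rw [hs1, indicator_of_mem hx, Pi.one_apply]
  refine ⟨s, hs, hs0, h1, fun A hA => ?_⟩
  have hsA : N ω A = (s ∩ A).encard := by
    rw [← measure_eq_encard_of_singleton_eq_one (hs.mono inter_subset_left)
      fun x hx => h1 x hx.1, inter_comm]
    exact (measure_inter_conull hs0).symm
  have hfin : (s ∩ A).Finite := by
    rw [← encard_ne_top_iff]
    intro h
    rw [hsA, h] at hA
    exact lt_irrefl _ hA
  have hc : N ω A = ((s ∩ A).ncard : ℝ≥0∞) := by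
    rw [hsA, ← hfin.cast_ncard_eq]
    rfl
  have hp : pointCount N A ω = (s ∩ A).ncard := by simp [pointCount, hc]
  exact ⟨hfin, hp, by rw [hp, hc]⟩

/-- The `n`-th power of a simple counting measure counts `n`-tuples of its points. Tuples of
distinct points with `a i` coordinates in `A i` are counted by falling factorials. -/
theorem IsPointProcess.pi_injective_eq_prod_descFactorial (hN : IsPointProcess N) (ω : Ω)
    {n : ℕ} {ι : Type*} [Fintype ι] {a : ι → ℕ} (e : Fin n ≃ Σ i, Fin (a i)) {A : ι → Set X}
    (hA : Pairwise fun i j => Disjoint (A i) (A j)) (hfin : ∀ i, N ω (A i) < ∞) :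
    (Measure.pi fun _ : Fin n => N ω) {x | Function.Injective x ∧ ∀ j, x j ∈ A (e j).1} =
      ∏ i, ((pointCount N (A i) ω).descFactorial (a i) : ℝ≥0∞) := by
  obtain ⟨s, hs, hs0, hs1, hcount⟩ := hN.exists_points_count ω
  have := hN.sigmaFinite ω
  have hae : (Measure.pi fun _ : Fin n => N ω) (univ.pi fun _ => s)ᶜ = 0 := by
    have : ∀ᵐ x ∂(Measure.pi fun _ : Fin n => N ω), ∀ i, x i ∈ s :=
      ae_all_iff.2 fun i => (Measure.quasiMeasurePreserving_eval (fun _ : Fin n => N ω) i).ae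
        (show ∀ᵐ y ∂(N ω), y ∈ s from hs0)
    refine mem_ae_iff.1 ?_
    filter_upwards [this] with x hx i _ using hx i
  have hset : {x : Fin n → X | Function.Injective x ∧ ∀ j, x j ∈ A (e j).1} ∩ univ.pi (fun _ => s) =
      {x | Function.Injective x ∧ ∀ j, x j ∈ (fun i => s ∩ A i) (e j).1} := by
    ext x
    simp only [mem_inter_iff, mem_pi, mem_univ, true_implies, mem_ofPred_eq, forall_and]
    tauto
  rw [← measure_inter_conull hae, hset, measure_eq_encard_of_singleton_eq_one,
    encard_injectiveFamily e (fun i j hij => (hA hij).mono inter_subset_right inter_subset_right)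
      fun i => (hcount _ (hfin i)).1]
  · simp only [← (hcount _ (hfin _)).2.1]
    rw [ENat.toENNReal_coe, Nat.cast_prod]
  · refine (countable_pi (s := fun _ : Fin n => s) fun _ => hs).mono ?_
    exact fun x hx i => (hx.2 i).1
  · intro x hx
    rw [Measure.pi_singleton]
    exact Finset.prod_eq_one fun i _ => hs1 _ (hx.2 i).1

end Count

theorem IsTPointProcess.ae_lt_top {X Ω : Type*} [PseudoMetricSpace X]
    [MeasurableSpace X] [MeasurableSpace Ω] {μ : Measure X} {T : X ≃ᵐ X} {P : Measure Ω}
    {S : Ω ≃ᵐ Ω} {N : Ω → Measure X} (hN : IsTPointProcess μ T P S N) (hmom : HasAllMoments μ P N)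
    {A : Set X} (hA : MeasurableSet A) (hμA : μ A < ∞) : ∀ᵐ ω ∂P, N ω A < ∞ := by
  rcases eq_or_ne (μ A) 0 with h0 | h0
  · filter_upwards [hN.null A hA h0] with ω hω
    simp [hω]
  · have h1 := hmom 1 le_rfl A hA (pos_iff_ne_zero.2 h0) hμA
    simp only [pow_one] at h1
    exact MeasureTheory.ae_lt_top
      ((Measure.measurable_coe hA).comp hN.pointProcess.measurable) h1.ne

section FactorialMoments

variable {X Ω : Type*} [MetricSpace X] [MeasurableSpace X] [BorelSpace X] [MeasurableSpace Ω]
  {μ : Measure X} {T : X ≃ᵐ X} {P : Measure Ω} {S : Ω ≃ᵐ Ω} {N : Ω → Measure X}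

theorem exists_isBounded_pos (h0 : μ ≠ 0) :
    ∃ B : Set X, MeasurableSet B ∧ Bornology.IsBounded B ∧ 0 < μ B := by
  have hX : Nonempty X := by
    by_contra h
    rw [not_nonempty_iff] at h
    exact h0 (Measure.eq_zero_of_isEmpty μ)
  obtain ⟨x⟩ := hX
  by_contra! h
  refine h0 (Measure.measure_univ_eq_zero.1 ?_)
  rw [← Metric.iUnion_closedBall_nat x, measure_iUnion_null_iff]
  intro n
  by_contra hn
  exact hn (le_antisymm (h (Metric.closedBall x n) Metric.isClosed_closedBall.measurableSet
    Metric.isBounded_closedBall) bot_le)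

/-- Off the diagonals, the moment measure of a free process is a multiple of the product measure:
freeness leaves only points with coordinates on distinct orbits, where (P2) forces
proportionality. -/
theorem exists_momentMeasure_eq_mul_pi [Nonempty X] [SecondCountableTopology X]
    [NullSingletonClass μ] (hμ : BoundedlyFinite μ) (h0 : μ ≠ 0) (hP2 : PropertyP2 μ T)
    (hN : IsTPointProcess μ T P S N) (hfree : IsFreeProcess P S N) (hmom : HasAllMoments μ P N)
    {n : ℕ} (hn : 1 ≤ n) :
    ∃ c : ℝ≥0, ∀ E : Set (Fin n → X), MeasurableSet E → E ⊆ {x | Function.Injective x} →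
      momentMeasure P N n E = c * Measure.pi (fun _ => μ) E := by
  have := hμ.sigmaFinite
  obtain ⟨B, hB, hBb, hB0⟩ := exists_isBounded_pos h0
  have hDm := measurableSet_orbitFreeSet T n
  have hD0 : (Measure.pi fun _ : Fin n => μ) (orbitFreeSet T n)ᶜ = 0 := pi_compl_orbitFreeSet T n
  have hR : MeasurableSet (univ.pi fun _ : Fin n => B) := MeasurableSet.univ_pi fun _ => hB
  set Q : Set (Fin n → X) := (univ.pi fun _ : Fin n => B) ∩ orbitFreeSet T n with hQ
  have hπQ : (Measure.pi fun _ : Fin n => μ) Q = μ B ^ n := by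
    rw [hQ, measure_inter_conull hD0, Measure.pi_pi]
    simp
  have hπ0 : (Measure.pi fun _ : Fin n => μ) Q ≠ 0 := by
    rw [hπQ]
    exact pow_ne_zero _ hB0.ne'
  have hπtop : (Measure.pi fun _ : Fin n => μ) Q ≠ ∞ := by
    rw [hπQ]
    exact ENNReal.pow_ne_top (hμ B hBb).ne
  have hM := boundedlyFinite_momentMeasure hN hμ hmom hn
  have hMQ : momentMeasure P N n Q ≠ ∞ := ne_top_of_le_ne_top
    (hM _ (Bornology.IsBounded.pi fun _ => hBb)).ne (measure_mono inter_subset_left)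
  refine ⟨(momentMeasure P N n Q / (Measure.pi fun _ : Fin n => μ) Q).toNNReal,
    fun E hE hEinj => ?_⟩
  -- freeness: tuples of distinct points of `N` have coordinates on distinct orbits
  have h1 : momentMeasure P N n E = momentMeasure P N n (E ∩ orbitFreeSet T n) := by
    refine (measure_inter_add_sdiff E hDm).symm.trans ?_
    rw [measure_mono_null (sdiff_subset_sdiff_left hEinj)
      (momentMeasure_injective_diff_orbitFreeSet hN hfree n), add_zero]
  have h2 := hP2.mul_pi_eq hn hM (measurePreserving_momentMeasure hN n)
    (fun i => map_eval_momentMeasure_absolutelyContinuous hN i) (hE.inter hDm) (hR.inter hDm)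
    inter_subset_right inter_subset_right
  rw [ENNReal.coe_toNNReal (ENNReal.div_ne_top hMQ hπ0), h1, ← measure_inter_conull (s := E) hD0,
    ← ENNReal.mul_div_right_comm, ← h2, ENNReal.mul_div_cancel_right hπ0 hπtop]

/-- The joint factorial moments of the numbers of points in disjoint sets of finite measure, in
terms of constants depending only on the total order. -/
theorem exists_lintegral_prod_descFactorial [Nonempty X] [SecondCountableTopology X]
    [NullSingletonClass μ] [IsProbabilityMeasure P] (hμ : BoundedlyFinite μ) (h0 : μ ≠ 0)
    (hP2 : PropertyP2 μ T) (hN : IsTPointProcess μ T P S N) (hfree : IsFreeProcess P S N)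
    (hmom : HasAllMoments μ P N) :
    ∃ c : ℕ → ℝ≥0, c 0 = 1 ∧ HasFactorialMoments μ P N c := by
  have := hμ.sigmaFinite
  have := hN.pointProcess.sigmaFinite
  have hex : ∀ n : ℕ, ∃ c : ℝ≥0, 1 ≤ n → ∀ E : Set (Fin n → X), MeasurableSet E →
      E ⊆ {x | Function.Injective x} →
      momentMeasure P N n E = c * Measure.pi (fun _ => μ) E := fun n => by
    by_cases hn : 1 ≤ n
    · obtain ⟨c, hc⟩ := exists_momentMeasure_eq_mul_pi hμ h0 hP2 hN hfree hmom hn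
      exact ⟨c, fun _ => hc⟩
    · exact ⟨0, fun h => absurd h hn⟩
  choose c hc using hex
  refine ⟨fun n => if n = 0 then 1 else c n, if_pos rfl, fun ι _ a A hA hfin hdisj => ?_⟩
  dsimp only
  split_ifs with hsum
  · have ha : ∀ i, a i = 0 := by simpa using hsum
    simp [ha]
  set n := ∑ i, a i with hn
  -- `e` labels the coordinates: the `j`-th one is to lie in `A (e j).1`
  have e : Fin n ≃ Σ i, Fin (a i) := (Fintype.equivFinOfCardEq (by simp [hn])).symm
  set E : Set (Fin n → X) := {x | Function.Injective x ∧ ∀ j, x j ∈ A (e j).1} with hE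
  have hEeq : E = {x : Fin n → X | Function.Injective x} ∩ univ.pi fun j => A (e j).1 := by
    ext x
    simp [hE]
  have hEm : MeasurableSet E := by
    rw [hEeq]
    exact (measurableSet_injective n).inter (MeasurableSet.univ_pi fun j => hA _)
  have h1 : momentMeasure P N n E =
      ∫⁻ ω, ∏ i, ((pointCount N (A i) ω).descFactorial (a i) : ℝ≥0∞) ∂P := by
    rw [momentMeasure_apply hN.pointProcess hEm]
    refine lintegral_congr_ae ?_
    filter_upwards [ae_all_iff.2 fun i => hN.ae_lt_top hmom (hA i) (hfin i)] with ω hω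
    exact hN.pointProcess.pi_injective_eq_prod_descFactorial ω e hdisj hω
  have hinj : (Measure.pi fun _ : Fin n => μ) {x | Function.Injective x}ᶜ = 0 :=
    measure_mono_null (compl_subset_compl.2 (orbitFreeSet_subset_injective T n))
      (pi_compl_orbitFreeSet T n)
  rw [← h1, hc n (Nat.one_le_iff_ne_zero.2 hsum) E hEm fun x hx => hx.1, hEeq, inter_comm,
    measure_inter_conull hinj, Measure.pi_pi]
  congr 1
  rw [Fintype.prod_equiv e (fun j => μ (A (e j).1)) (fun p => μ (A p.1)) fun _ => rfl,
    Fintype.prod_sigma]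
  simp

end FactorialMoments

/-! ### A mean ergodic argument in `L²` -/

theorem norm_toLp_sub_toLp_sq {Ω : Type*} [MeasurableSpace Ω] {P : Measure Ω} {f g : Ω → ℝ}
    (hf : MemLp f 2 P) (hg : MemLp g 2 P) :
    ‖hf.toLp f - hg.toLp g‖ ^ 2 = ∫ ω, (f ω - g ω) ^ 2 ∂P := by
  rw [← MemLp.toLp_sub, ← real_inner_self_eq_norm_sq, L2.inner_def]
  refine integral_congr_ae ?_
  filter_upwards [(hf.sub hg).coeFn_toLp] with ω hω
  rw [hω]
  simp [sq]

/-- An `L²`-Cauchy sequence that is asymptotically invariant under an ergodic transformation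
converges to a constant; only the weak form of the convergence is recorded. -/
theorem exists_tendsto_integral_mul_of_ergodic {Ω : Type*} [MeasurableSpace Ω] {P : Measure Ω}
    [IsProbabilityMeasure P] {S : Ω → Ω} (hS : Ergodic S P) {f : ℕ → Ω → ℝ}
    (hf : ∀ r, MemLp (f r) 2 P) {e : ℕ → ℝ} (he : Filter.Tendsto e Filter.atTop (nhds 0))
    (hfe : ∀ r s, ∫ ω, (f r ω - f s ω) ^ 2 ∂P ≤ e r + e s)
    (hfS : ∀ r, ∫ ω, (f r (S ω) - f r ω) ^ 2 ∂P ≤ e r) :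
    ∃ α : ℝ, ∀ Z : Ω → ℝ, MemLp Z 2 P → Filter.Tendsto (fun r => ∫ ω, Z ω * f r ω ∂P)
      Filter.atTop (nhds (α * ∫ ω, Z ω ∂P)) := by
  have hSm := hS.toMeasurePreserving
  set F : ℕ → Lp ℝ 2 P := fun r => (hf r).toLp (f r) with hF
  have hcau : CauchySeq F := by
    refine Metric.cauchySeq_iff.2 fun ε hε => ?_
    have h1 : ∀ᶠ r in Filter.atTop, e r < ε ^ 2 / 2 := he.eventually_lt_const (by positivity)
    obtain ⟨M, hM⟩ := Filter.eventually_atTop.1 h1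
    refine ⟨M, fun m hm n hn => lt_of_pow_lt_pow_left₀ 2 hε.le ?_⟩
    rw [dist_eq_norm, norm_toLp_sub_toLp_sq]
    linarith [hfe m n, hM m hm, hM n hn]
  obtain ⟨G, hG⟩ := cauchySeq_tendsto_of_complete hcau
  have hinv : Lp.compMeasurePreserving S hSm G = G := by
    have h1 : Filter.Tendsto (fun r => Lp.compMeasurePreserving S hSm (F r)) Filter.atTop
        (nhds (Lp.compMeasurePreserving S hSm G)) :=
      ((Lp.isometry_compMeasurePreserving hSm).continuous.tendsto G).comp hG
    have h2 : Filter.Tendsto (fun r => Lp.compMeasurePreserving S hSm (F r) - F r) Filter.atTop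
        (nhds 0) := by
      rw [tendsto_zero_iff_norm_tendsto_zero]
      have h3 : ∀ r, ‖Lp.compMeasurePreserving S hSm (F r) - F r‖ ^ 2 ≤ e r := fun r => by
        rw [hF, Lp.toLp_compMeasurePreserving (hf r) hSm, norm_toLp_sub_toLp_sq]
        exact hfS r
      have h4 := squeeze_zero (fun r => sq_nonneg _) h3 he
      simpa [Real.sqrt_sq (norm_nonneg _)] using h4.sqrt
    have h3 := h1.sub hG
    exact sub_eq_zero.1 (tendsto_nhds_unique h3 h2)
  obtain ⟨α, hα⟩ := hS.ae_eq_const_of_ae_eq_comp_ae (Lp.aestronglyMeasurable G) (by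
    have h := Lp.coeFn_compMeasurePreserving G hSm
    rw [hinv] at h
    exact h.symm)
  refine ⟨α, fun Z hZ => ?_⟩
  have h1 : Filter.Tendsto (fun r => inner ℝ (hZ.toLp Z) (F r)) Filter.atTop
      (nhds (inner ℝ (hZ.toLp Z) G)) := tendsto_const_nhds.inner hG
  have h2 : ∀ r, inner ℝ (hZ.toLp Z) (F r) = ∫ ω, Z ω * f r ω ∂P := fun r => by
    rw [L2.inner_def]
    refine integral_congr_ae ?_
    filter_upwards [hZ.coeFn_toLp, (hf r).coeFn_toLp] with ω h1 h2
    rw [h1, h2]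
    simp [mul_comm]
  have h3 : inner ℝ (hZ.toLp Z) G = α * ∫ ω, Z ω ∂P := by
    rw [L2.inner_def, ← integral_const_mul]
    refine integral_congr_ae ?_
    filter_upwards [hZ.coeFn_toLp, hα] with ω h1 h2
    rw [h1, h2]
    simp
  simp_rw [h2, h3] at h1
  exact h1

/-! ### The constants in the factorial moments are powers of the intensity -/

theorem integrable_and_integral_eq_of_lintegral_natCast {Ω : Type*} [MeasurableSpace Ω]
    {P : Measure Ω} {K : Ω → ℕ} (hK : Measurable K) {l : ℝ≥0}
    (h : ∫⁻ ω, (K ω : ℝ≥0∞) ∂P = l) :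
    Integrable (fun ω => (K ω : ℝ)) P ∧ ∫ ω, (K ω : ℝ) ∂P = l := by
  have hm : AEStronglyMeasurable (fun ω => (K ω : ℝ)) P :=
    ((Measurable.of_discrete (f := fun k : ℕ => (k : ℝ))).comp hK).aestronglyMeasurable
  have h' : ∫⁻ ω, ENNReal.ofReal (K ω : ℝ) ∂P = l := by simpa using h
  refine ⟨⟨hm, ?_⟩, ?_⟩
  · rw [hasFiniteIntegral_iff_ofReal (Filter.Eventually.of_forall fun ω => Nat.cast_nonneg _), h']
    exact ENNReal.coe_lt_top
  · rw [integral_eq_lintegral_of_nonneg_ae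
      (Filter.Eventually.of_forall fun ω => Nat.cast_nonneg _) hm, h', ENNReal.coe_toReal]

section Intensity

variable {X Ω : Type*} [MeasurableSpace X] [MeasurableSpace Ω]
  {μ : Measure X} {T : X ≃ᵐ X} {P : Measure Ω} {S : Ω ≃ᵐ Ω} {N : Ω → Measure X}

theorem HasFactorialMoments.integral_prod {c : ℕ → ℝ≥0} (h : HasFactorialMoments μ P N c)
    (hN : Measurable N) {ι : Type} [Fintype ι] (a : ι → ℕ) (A : ι → Set X)
    (hA : ∀ i, MeasurableSet (A i)) (hfin : ∀ i, μ (A i) < ∞)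
    (hdisj : Pairwise (fun i j => Disjoint (A i) (A j))) :
    Integrable (fun ω => ∏ i, ((pointCount N (A i) ω).descFactorial (a i) : ℝ)) P ∧
    ∫ ω, ∏ i, ((pointCount N (A i) ω).descFactorial (a i) : ℝ) ∂P =
      c (∑ i, a i) * ∏ i, (μ (A i)).toReal ^ a i := by
  have hm : Measurable fun ω => ∏ i, (pointCount N (A i) ω).descFactorial (a i) :=
    Finset.measurable_prod _ fun i _ =>
      (Measurable.of_discrete (f := fun k : ℕ => k.descFactorial (a i))).comp
        (measurable_pointCount hN (hA i))
  have h1 := integrable_and_integral_eq_of_lintegral_natCast (P := P) hm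
    (l := c (∑ i, a i) * ∏ i, (μ (A i)).toNNReal ^ a i) (by
      push_cast
      simp_rw [ENNReal.coe_toNNReal (hfin _).ne]
      exact h ι a A hA hfin hdisj)
  push_cast at h1
  exact h1

theorem HasFactorialMoments.integral_one {c : ℕ → ℝ≥0} (h : HasFactorialMoments μ P N c)
    (hN : Measurable N) (n : ℕ) {A : Set X} (hA : MeasurableSet A) (hfin : μ A < ∞) :
    Integrable (fun ω => ((pointCount N A ω).descFactorial n : ℝ)) P ∧
    ∫ ω, ((pointCount N A ω).descFactorial n : ℝ) ∂P = c n * (μ A).toReal ^ n := by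
  simpa using h.integral_prod hN (fun _ : Unit => n) (fun _ => A) (fun _ => hA) (fun _ => hfin)
    (fun i j hij => absurd (Subsingleton.elim i j) hij)

theorem HasFactorialMoments.integral_two {c : ℕ → ℝ≥0} (h : HasFactorialMoments μ P N c)
    (hN : Measurable N) (n : ℕ) {A B : Set X} (hA : MeasurableSet A) (hfin : μ A < ∞)
    (hB : MeasurableSet B) (hfinB : μ B < ∞) (hAB : Disjoint A B) :
    Integrable (fun ω => ((pointCount N A ω).descFactorial n : ℝ) * pointCount N B ω) P ∧
    ∫ ω, ((pointCount N A ω).descFactorial n : ℝ) * pointCount N B ω ∂P =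
      c (n + 1) * (μ A).toReal ^ n * (μ B).toReal := by
  have h1 := h.integral_prod hN ![n, 1] ![A, B] (by simp [Fin.forall_fin_two, hA, hB])
    (by simp [Fin.forall_fin_two, hfin, hfinB]) (by
      intro i j hij
      fin_cases i <;> fin_cases j <;> simp_all [disjoint_comm])
  simpa [Fin.prod_univ_two, Fin.sum_univ_two, mul_assoc] using h1

theorem HasFactorialMoments.integral_sq {c : ℕ → ℝ≥0} (h : HasFactorialMoments μ P N c)
    (hN : Measurable N) {A : Set X} (hA : MeasurableSet A) (hfin : μ A < ∞) :
    Integrable (fun ω => (pointCount N A ω : ℝ) ^ 2) P ∧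
    ∫ ω, (pointCount N A ω : ℝ) ^ 2 ∂P = c 2 * (μ A).toReal ^ 2 + c 1 * (μ A).toReal := by
  obtain ⟨i1, h1⟩ := h.integral_one hN 1 hA hfin
  obtain ⟨i2, h2⟩ := h.integral_one hN 2 hA hfin
  have heq : ∀ ω, (pointCount N A ω : ℝ) ^ 2 = ((pointCount N A ω).descFactorial 2 : ℝ) +
      ((pointCount N A ω).descFactorial 1 : ℝ) := fun ω => by
    rw [Nat.cast_descFactorial_two, Nat.descFactorial_one]
    ring
  simp_rw [heq]
  exact ⟨i2.add i1, by rw [integral_add i2 i1, h1, h2, pow_one]⟩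

theorem pointCount_union_ae [MetricSpace X] [BorelSpace X] (hN : IsTPointProcess μ T P S N)
    (hmom : HasAllMoments μ P N)
    {A B : Set X} (hA : MeasurableSet A) (hfin : μ A < ∞) (hB : MeasurableSet B)
    (hfinB : μ B < ∞) (hAB : Disjoint A B) :
    ∀ᵐ ω ∂P, pointCount N (A ∪ B) ω = pointCount N A ω + pointCount N B ω := by
  filter_upwards [hN.ae_lt_top hmom hA hfin, hN.ae_lt_top hmom hB hfinB] with ω h1 h2
  obtain ⟨s, -, -, -, hs⟩ := hN.pointProcess.exists_points_count ω
  have h3 : N ω (A ∪ B) = N ω A + N ω B := measure_union hAB hB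
  have h4 : N ω (A ∪ B) < ∞ := by
    rw [h3]
    exact ENNReal.add_lt_top.2 ⟨h1, h2⟩
  rw [(hs _ h4).2.2, (hs _ h1).2.2, (hs _ h2).2.2] at h3
  exact_mod_cast h3

end Intensity

theorem HasFactorialMoments.memLp_pointCount {X Ω : Type*} [MeasurableSpace X]
    [MeasurableSpace Ω] {μ : Measure X} {P : Measure Ω} {N : Ω → Measure X} {c : ℕ → ℝ≥0}
    (h : HasFactorialMoments μ P N c) (hN : Measurable N) {A : Set X} (hA : MeasurableSet A)
    (hfin : μ A < ∞) :
    MemLp (fun ω => (pointCount N A ω : ℝ)) 2 P := by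
  refine (memLp_two_iff_integrable_sq ?_).2 (h.integral_sq hN hA hfin).1
  exact ((Measurable.of_discrete (f := fun k : ℕ => (k : ℝ))).comp
    (measurable_pointCount hN hA)).aestronglyMeasurable

section Intensity

variable {X Ω : Type*} [MetricSpace X] [MeasurableSpace X] [BorelSpace X] [MeasurableSpace Ω]
  {μ : Measure X} {T : X ≃ᵐ X} {P : Measure Ω} {S : Ω ≃ᵐ Ω} {N : Ω → Measure X}

/-- Square integrability of the `n`-th falling factorial comes from the moment of order `2n`. -/
theorem memLp_descFactorial_pointCount (hN : IsTPointProcess μ T P S N)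
    (hmom : HasAllMoments μ P N) {A : Set X} (hA : MeasurableSet A) (h0 : 0 < μ A)
    (hfin : μ A < ∞) {n : ℕ} (hn : 1 ≤ n) :
    MemLp (fun ω => ((pointCount N A ω).descFactorial n : ℝ)) 2 P := by
  have hNm := hN.pointProcess.measurable
  have hm := measurable_pointCount hNm hA
  refine (memLp_two_iff_integrable_sq ?_).2 ?_
  · exact ((Measurable.of_discrete (f := fun k : ℕ => (k.descFactorial n : ℝ))).comp
      hm).aestronglyMeasurable
  have hfinite : ∫⁻ ω, ((((pointCount N A ω).descFactorial n) ^ 2 : ℕ) : ℝ≥0∞) ∂P < ∞ := by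
    refine lt_of_le_of_lt (lintegral_mono_ae ?_) (hmom (n * 2) (by omega) A hA h0 hfin)
    filter_upwards [hN.ae_lt_top hmom hA hfin] with ω hω
    obtain ⟨s, -, -, -, hs⟩ := hN.pointProcess.exists_points_count ω
    rw [(hs _ hω).2.2, pow_mul]
    exact_mod_cast Nat.pow_le_pow_left (Nat.descFactorial_le_pow _ _) 2
  have hm2 : Measurable fun ω => (pointCount N A ω).descFactorial n ^ 2 :=
    (Measurable.of_discrete (f := fun k : ℕ => k.descFactorial n ^ 2)).comp hm
  have := (integrable_and_integral_eq_of_lintegral_natCast hm2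
    (ENNReal.coe_toNNReal hfinite.ne).symm).1
  simpa using this

/-- The second moments of the counts, for sets that may overlap: both are split into their common
part and the rest. -/
theorem HasFactorialMoments.integral_mul {c : ℕ → ℝ≥0} (h : HasFactorialMoments μ P N c)
    (hN : IsTPointProcess μ T P S N) (hmom : HasAllMoments μ P N) {A B : Set X}
    (hA : MeasurableSet A) (hfin : μ A < ∞) (hB : MeasurableSet B) (hfinB : μ B < ∞) :
    ∫ ω, (pointCount N A ω : ℝ) * pointCount N B ω ∂P =
      c 2 * (μ A).toReal * (μ B).toReal + c 1 * (μ (A ∩ B)).toReal := by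
  have hNm := hN.pointProcess.measurable
  have hU := hA.inter hB
  have hV := hA.diff hB
  have hW := hB.diff hA
  have fU : μ (A ∩ B) < ∞ := (measure_mono inter_subset_left).trans_lt hfin
  have fV : μ (A \ B) < ∞ := (measure_mono sdiff_subset).trans_lt hfin
  have fW : μ (B \ A) < ∞ := (measure_mono sdiff_subset).trans_lt hfinB
  have dUV : Disjoint (A ∩ B) (A \ B) := disjoint_sdiff_inter.symm
  have dUW : Disjoint (A ∩ B) (B \ A) := disjoint_sdiff_right.mono_left inter_subset_left
  have dVW : Disjoint (A \ B) (B \ A) := disjoint_sdiff_right.mono_left sdiff_subset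
  have eA := pointCount_union_ae hN hmom hU fU hV fV dUV
  have eB := pointCount_union_ae hN hmom hU fU hW fW dUW
  rw [inter_union_sdiff] at eA
  rw [inter_comm, inter_union_sdiff, inter_comm] at eB
  obtain ⟨i1, h1⟩ := h.integral_sq hNm hU fU
  obtain ⟨i2, h2⟩ := h.integral_two hNm 1 hU fU hV fV dUV
  obtain ⟨i3, h3⟩ := h.integral_two hNm 1 hU fU hW fW dUW
  obtain ⟨i4, h4⟩ := h.integral_two hNm 1 hV fV hW fW dVW
  simp only [Nat.descFactorial_one, pow_one] at i2 h2 i3 h3 i4 h4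
  have hmA : (μ A).toReal = (μ (A ∩ B)).toReal + (μ (A \ B)).toReal := by
    rw [← ENNReal.toReal_add fU.ne fV.ne, measure_inter_add_sdiff A hB]
  have hmB : (μ B).toReal = (μ (A ∩ B)).toReal + (μ (B \ A)).toReal := by
    rw [← ENNReal.toReal_add fU.ne fW.ne, inter_comm, measure_inter_add_sdiff B hA]
  have heq : (fun ω => (pointCount N A ω : ℝ) * pointCount N B ω) =ᵐ[P] fun ω =>
      (pointCount N (A ∩ B) ω : ℝ) ^ 2 +
      (pointCount N (A ∩ B) ω : ℝ) * pointCount N (A \ B) ω +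
      (pointCount N (A ∩ B) ω : ℝ) * pointCount N (B \ A) ω +
      (pointCount N (A \ B) ω : ℝ) * pointCount N (B \ A) ω := by
    filter_upwards [eA, eB] with ω h1 h2
    rw [h1, h2]
    push_cast
    ring
  have j12 : Integrable (fun ω => (pointCount N (A ∩ B) ω : ℝ) ^ 2 +
      (pointCount N (A ∩ B) ω : ℝ) * pointCount N (A \ B) ω) P := i1.add i2
  have j123 : Integrable (fun ω => (pointCount N (A ∩ B) ω : ℝ) ^ 2 +
      (pointCount N (A ∩ B) ω : ℝ) * pointCount N (A \ B) ω +
      (pointCount N (A ∩ B) ω : ℝ) * pointCount N (B \ A) ω) P := j12.add i3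
  rw [integral_congr_ae heq, integral_add j123 i4, integral_add j12 i3, integral_add i1 i2,
    h1, h2, h3, h4, hmA, hmB]
  ring

/-- In the variance of the difference of two normalized counts the second order constant cancels. -/
theorem HasFactorialMoments.integral_sub_sq_le {c : ℕ → ℝ≥0} (h : HasFactorialMoments μ P N c)
    (hN : IsTPointProcess μ T P S N) (hmom : HasAllMoments μ P N) {A B : Set X}
    (hA : MeasurableSet A) (h0 : 0 < μ A) (hfin : μ A < ∞) (hB : MeasurableSet B) (h0B : 0 < μ B)
    (hfinB : μ B < ∞) :
    ∫ ω, (pointCount N A ω / (μ A).toReal - pointCount N B ω / (μ B).toReal) ^ 2 ∂P ≤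
      c 1 / (μ A).toReal + c 1 / (μ B).toReal := by
  have hNm := hN.pointProcess.measurable
  have ha : 0 < (μ A).toReal := ENNReal.toReal_pos h0.ne' hfin.ne
  have hb : 0 < (μ B).toReal := ENNReal.toReal_pos h0B.ne' hfinB.ne
  obtain ⟨i1, h1⟩ := h.integral_sq hNm hA hfin
  obtain ⟨i2, h2⟩ := h.integral_sq hNm hB hfinB
  have h3 := h.integral_mul hN hmom hA hfin hB hfinB
  have i3 : Integrable (fun ω => (pointCount N A ω : ℝ) * pointCount N B ω) P :=
    (h.memLp_pointCount hNm hA hfin).integrable_mul (h.memLp_pointCount hNm hB hfinB)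
  set a := (μ A).toReal
  set b := (μ B).toReal
  have heq : ∀ ω, ((pointCount N A ω : ℝ) / a - pointCount N B ω / b) ^ 2 =
      (1 / a ^ 2) * (pointCount N A ω : ℝ) ^ 2 + (1 / b ^ 2) * (pointCount N B ω : ℝ) ^ 2 -
      (2 / (a * b)) * ((pointCount N A ω : ℝ) * pointCount N B ω) := fun ω => by
    field_simp
    ring
  simp_rw [heq]
  have j12 : Integrable (fun ω => (1 / a ^ 2) * (pointCount N A ω : ℝ) ^ 2 +
      (1 / b ^ 2) * (pointCount N B ω : ℝ) ^ 2) P := (i1.const_mul _).add (i2.const_mul _)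
  rw [integral_sub j12 (i3.const_mul _),
    integral_add (i1.const_mul _) (i2.const_mul _), integral_const_mul, integral_const_mul,
    integral_const_mul, h1, h2, h3]
  have hnn : 0 ≤ 2 / (a * b) * (c 1 * (μ (A ∩ B)).toReal) := by positivity
  have : 1 / a ^ 2 * (c 2 * a ^ 2 + c 1 * a) + 1 / b ^ 2 * (c 2 * b ^ 2 + c 1 * b) -
      2 / (a * b) * (c 2 * a * b + c 1 * (μ (A ∩ B)).toReal) =
      c 1 / a + c 1 / b - 2 / (a * b) * (c 1 * (μ (A ∩ B)).toReal) := by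
    field_simp
    ring
  rw [this]
  linarith

/-- The normalized counts in an exhausting sequence of balls converge to a constant, the mean number
of points per unit of measure, and testing this against `(N(B))_n` for a fixed ball gives
`c (n + 1) = α c n`. -/
theorem HasFactorialMoments.exists_eq_pow [Nonempty X] [IsProbabilityMeasure P]
    {c : ℕ → ℝ≥0} (h : HasFactorialMoments μ P N c) (hc0 : c 0 = 1)
    (hμ : BoundedlyFinite μ) (hinf : μ univ = ∞) (hT : MeasurePreserving T μ μ)
    (hS : Ergodic S P) (hN : IsTPointProcess μ T P S N) (hmom : HasAllMoments μ P N) :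
    ∃ α : ℝ≥0, ∀ n, c n = α ^ n := by
  obtain ⟨x⟩ := ‹Nonempty X›
  have hNm := hN.pointProcess.measurable
  have hball : Filter.Tendsto (fun r : ℕ => μ (Metric.closedBall x r)) Filter.atTop (nhds ∞) := by
    have hmono : Monotone fun r : ℕ => Metric.closedBall x (r : ℝ) := fun r s hrs =>
      Metric.closedBall_subset_closedBall (by exact_mod_cast hrs)
    have := tendsto_measure_iUnion_atTop (μ := μ) hmono
    rwa [Metric.iUnion_closedBall_nat, hinf] at this
  -- the radii start at `r0`, so that all normalizing constants are positive
  obtain ⟨r0, hr0⟩ := (hball.eventually_const_lt (u := 0) ENNReal.zero_lt_top).exists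
  set B : ℕ → Set X := fun r => Metric.closedBall x ((r + r0 : ℕ) : ℝ) with hB
  have hBm : ∀ r, MeasurableSet (B r) := fun r => Metric.isClosed_closedBall.measurableSet
  have hBfin : ∀ r, μ (B r) < ∞ := fun r => hμ _ Metric.isBounded_closedBall
  have hB0sub : ∀ r, B 0 ⊆ B r := fun r =>
    Metric.closedBall_subset_closedBall (by push_cast; simp)
  have hBpos0 : 0 < μ (B 0) := by simpa [hB] using hr0
  have hBpos : ∀ r, 0 < μ (B r) := fun r => hBpos0.trans_le (measure_mono (hB0sub r))
  have hbpos : ∀ r, 0 < (μ (B r)).toReal := fun r => ENNReal.toReal_pos (hBpos r).ne' (hBfin r).ne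
  have hb : Filter.Tendsto (fun r => (μ (B r)).toReal) Filter.atTop Filter.atTop := by
    have h1 : Filter.Tendsto (fun r => μ (B r)) Filter.atTop (nhds ∞) :=
      hball.comp (Filter.tendsto_add_atTop_nat r0)
    refine Filter.tendsto_atTop.2 fun C => ?_
    filter_upwards [h1.eventually_const_lt (u := ENNReal.ofReal C) ENNReal.ofReal_lt_top] with r hr
    exact (ENNReal.ofReal_le_iff_le_toReal (hBfin r).ne).1 hr.le
  have he : Filter.Tendsto (fun r => 2 * ((c 1 : ℝ) / (μ (B r)).toReal)) Filter.atTop (nhds 0) := by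
    simpa using (hb.const_div_atTop (c 1 : ℝ)).const_mul 2
  obtain ⟨α, hα⟩ := exists_tendsto_integral_mul_of_ergodic hS
    (f := fun r ω => (pointCount N (B r) ω : ℝ) / (μ (B r)).toReal)
    (fun r => by
      simpa [div_eq_inv_mul] using
        (h.memLp_pointCount hNm (hBm r) (hBfin r)).const_mul (μ (B r)).toReal⁻¹) he
    (fun r s => by
      have h1 := h.integral_sub_sq_le hN hmom (hBm r) (hBpos r) (hBfin r) (hBm s) (hBpos s)
        (hBfin s)
      have h2 : 0 ≤ (c 1 : ℝ) / (μ (B r)).toReal := by positivity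
      have h3 : 0 ≤ (c 1 : ℝ) / (μ (B s)).toReal := by positivity
      linarith)
    (fun r => by
      have hmeas : μ (T ⁻¹' B r) = μ (B r) := hT.measure_preimage (hBm r).nullMeasurableSet
      have h1 := h.integral_sub_sq_le hN hmom (T.measurable (hBm r)) (hmeas ▸ hBpos r)
        (hmeas ▸ hBfin r) (hBm r) (hBpos r) (hBfin r)
      rw [hmeas] at h1
      refine (le_of_eq (integral_congr_ae ?_)).trans (h1.trans (two_mul _).ge)
      filter_upwards [hN.equivariant (B r) (hBm r)] with ω hω
      simp only [pointCount, hω])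
  -- the mean of `(N(B₀))_n N(B_r) / μ(B_r)` is computed exactly by splitting `B₀` off `B_r`
  have hlim : ∀ n, MemLp (fun ω => ((pointCount N (B 0) ω).descFactorial n : ℝ)) 2 P →
      (c (n + 1) : ℝ) = α * c n := by
    intro n hn
    obtain ⟨-, hval⟩ := h.integral_one hNm n (hBm 0) (hBfin 0)
    have h1 := hα _ hn
    rw [hval] at h1
    set b : ℕ → ℝ := fun r => (μ (B r)).toReal with hbdef
    set κ : ℝ := ∫ ω, ((pointCount N (B 0) ω).descFactorial n : ℝ) * pointCount N (B 0) ω ∂P with hκ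
    have hexact : ∀ r, ∫ ω, ((pointCount N (B 0) ω).descFactorial n : ℝ) *
        (pointCount N (B r) ω / b r) ∂P =
        c (n + 1) * b 0 ^ n + (κ - c (n + 1) * b 0 ^ n * b 0) / b r := by
      intro r
      have hD := (hBm r).diff (hBm 0)
      have hDfin : μ (B r \ B 0) < ∞ := (measure_mono sdiff_subset).trans_lt (hBfin r)
      have hu := pointCount_union_ae hN hmom (hBm 0) (hBfin 0) hD hDfin disjoint_sdiff_right
      rw [union_sdiff_cancel (hB0sub r)] at hu
      obtain ⟨i2, h2⟩ := h.integral_two hNm n (hBm 0) (hBfin 0) hD hDfin disjoint_sdiff_right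
      have i3 : Integrable (fun ω => ((pointCount N (B 0) ω).descFactorial n : ℝ) *
          pointCount N (B 0) ω) P :=
        hn.integrable_mul (h.memLp_pointCount hNm (hBm 0) (hBfin 0))
      have heq : (fun ω => ((pointCount N (B 0) ω).descFactorial n : ℝ) *
          (pointCount N (B r) ω / b r)) =ᵐ[P] fun ω => (b r)⁻¹ *
          (((pointCount N (B 0) ω).descFactorial n : ℝ) * pointCount N (B 0) ω +
          ((pointCount N (B 0) ω).descFactorial n : ℝ) * pointCount N (B r \ B 0) ω) := by
        filter_upwards [hu] with ω hω
        rw [hω]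
        push_cast
        ring
      have hmD : (μ (B r \ B 0)).toReal = b r - b 0 := by
        rw [measure_sdiff (hB0sub r) (hBm 0).nullMeasurableSet (hBfin 0).ne,
          ENNReal.toReal_sub_of_le (measure_mono (hB0sub r)) (hBfin r).ne]
      rw [integral_congr_ae heq, integral_const_mul, integral_add i3 i2, h2, hmD, ← hκ]
      have : b r ≠ 0 := (hbpos r).ne'
      field_simp
      ring
    replace h1 := h1.congr hexact
    have h2 : Filter.Tendsto (fun r => c (n + 1) * b 0 ^ n +
        (κ - c (n + 1) * b 0 ^ n * b 0) / b r) Filter.atTop (nhds (c (n + 1) * b 0 ^ n)) := by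
      simpa using (hb.const_div_atTop (κ - c (n + 1) * b 0 ^ n * b 0)).const_add
        ((c (n + 1) : ℝ) * b 0 ^ n)
    have h3 := tendsto_nhds_unique h2 h1
    rw [← mul_assoc] at h3
    exact mul_right_cancel₀ (pow_ne_zero n (hbpos 0).ne') h3
  have hstep : ∀ n, (c (n + 1) : ℝ) = α * c n := fun n => by
    refine hlim n ?_
    rcases Nat.eq_zero_or_pos n with rfl | hn
    · simp only [Nat.descFactorial_zero, Nat.cast_one]
      exact memLp_const 1
    · exact memLp_descFactorial_pointCount hN hmom (hBm 0) hBpos0 (hBfin 0) hn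
  have hα1 : (c 1 : ℝ) = α := by simpa [hc0] using hstep 0
  refine ⟨c 1, fun n => ?_⟩
  induction n with
  | zero => simp [hc0]
  | succ n ih =>
    apply NNReal.coe_injective
    rw [hstep n, ih, ← hα1, pow_succ']
    push_cast
    ring

end Intensity

/-! ### Factorial moments determine independent Poisson variables -/

/-- Inclusion-exclusion: the indicator of `{m}` as an alternating series of falling factorials. -/
theorem hasSum_descFactorial_eq_ite (K m : ℕ) :
    HasSum (fun b : ℕ => (-1 : ℝ) ^ b / (m.factorial * b.factorial) * K.descFactorial (m + b))
      (if K = m then 1 else 0) := by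
  have hterm : ∀ b : ℕ, (-1 : ℝ) ^ b / (m.factorial * b.factorial) * K.descFactorial (m + b) =
      K.choose m * ((-1) ^ b * (K - m).choose b) := fun b => by
    have h1 := Nat.descFactorial_mul_descFactorial (n := K) (Nat.le_add_right m b)
    rw [Nat.add_sub_cancel_left, Nat.descFactorial_eq_factorial_mul_choose,
      Nat.descFactorial_eq_factorial_mul_choose K m] at h1
    rw [← h1]
    push_cast
    have := Nat.factorial_ne_zero m
    have := Nat.factorial_ne_zero b
    field_simp
  simp_rw [hterm]
  have h0 : ∀ b ∉ Finset.range (K - m + 1),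
      (K.choose m : ℝ) * ((-1) ^ b * (K - m).choose b) = 0 := fun b hb => by
    have hb' : K - m < b := by simpa [Nat.lt_succ_iff] using hb
    rw [Nat.choose_eq_zero_of_lt hb']
    simp
  have hs := hasSum_sum_of_ne_finset_zero h0 (L := SummationFilter.unconditional ℕ)
  convert! hs using 1
  have halt := congrArg (fun z : ℤ => (z : ℝ)) (Int.alternating_sum_range_choose (n := K - m))
  push_cast at halt
  rw [← Finset.mul_sum, halt]
  rcases lt_trichotomy K m with h | rfl | h
  · simp [h.ne, Nat.choose_eq_zero_of_lt h]
  · simp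
  · simp [h.ne', Nat.sub_ne_zero_of_lt h]

/-- If `K` has, for the density `H`, the factorial moments of a Poisson variable, then it has its
point probabilities. -/
theorem integral_ite_eq_of_descFactorial {Ω : Type*} [MeasurableSpace Ω] {P : Measure Ω}
    {K : Ω → ℕ} (hK : Measurable K) {H : Ω → ℝ} (hH : ∀ ω, 0 ≤ H ω) {C l : ℝ}
    (hint : ∀ a : ℕ, Integrable (fun ω => ((K ω).descFactorial a : ℝ) * H ω) P)
    (hval : ∀ a : ℕ, ∫ ω, ((K ω).descFactorial a : ℝ) * H ω ∂P = C * l ^ a) (m : ℕ) :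
    Integrable (fun ω => (if K ω = m then (1 : ℝ) else 0) * H ω) P ∧
      ∫ ω, (if K ω = m then (1 : ℝ) else 0) * H ω ∂P =
        C * (Real.exp (-l) * l ^ m / m.factorial) := by
  have hHint : Integrable H P := by simpa using hint 0
  constructor
  · refine hHint.mono (AEStronglyMeasurable.mul ?_ hHint.1)
      (Filter.Eventually.of_forall fun ω => ?_)
    · exact (Measurable.of_discrete (f := fun k : ℕ => if k = m then (1 : ℝ) else 0)).comp hK
        |>.aestronglyMeasurable
    · split_ifs <;> simp
  set F : ℕ → Ω → ℝ := fun b ω => (-1 : ℝ) ^ b / (m.factorial * b.factorial) *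
    (((K ω).descFactorial (m + b) : ℝ) * H ω) with hF
  have hFint : ∀ b, Integrable (F b) P := fun b => (hint _).const_mul _
  have hFnorm : ∀ b, ∫ ω, ‖F b ω‖ ∂P = C * l ^ m / m.factorial * (l ^ b / b.factorial) :=
    fun b => by
    have : ∀ ω, ‖F b ω‖ = 1 / (m.factorial * b.factorial) *
        (((K ω).descFactorial (m + b) : ℝ) * H ω) := fun ω => by
      simp [hF, abs_of_nonneg (hH ω)]
    simp_rw [this]
    rw [integral_const_mul, hval, pow_add]
    field_simp
  have hsum : Summable fun b => ∫ ω, ‖F b ω‖ ∂P := by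
    simp_rw [hFnorm]
    exact (Real.summable_pow_div_factorial l).mul_left _
  have h1 := hasSum_integral_of_summable_integral_norm hFint hsum
  have h2 : ∀ ω, ∑' b, F b ω = (if K ω = m then (1 : ℝ) else 0) * H ω := fun ω => by
    have := (hasSum_descFactorial_eq_ite (K ω) m).mul_right (H ω)
    simpa only [hF, mul_assoc] using this.tsum_eq
  simp_rw [h2] at h1
  have h3 : HasSum (fun b => ∫ ω, F b ω ∂P) (C * l ^ m / m.factorial * Real.exp (-l)) := by
    have hexp : HasSum (fun b : ℕ => (-l) ^ b / (b.factorial : ℝ)) (Real.exp (-l)) := by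
      rw [Real.exp_eq_exp_ℝ]
      exact NormedSpace.expSeries_div_hasSum_exp (-l)
    have hb : ∀ b, ∫ ω, F b ω ∂P = C * l ^ m / m.factorial * ((-l) ^ b / b.factorial) := fun b => by
      rw [hF, integral_const_mul, hval, pow_add, neg_pow l]
      field_simp
    simp_rw [hb]
    exact hexp.mul_left (C * l ^ m / m.factorial)
  rw [h1.unique h3]
  ring

/-- Natural-number valued variables with the joint factorial moments of independent Poisson
variables are independent Poisson variables. The point probabilities are obtained by replacing, one
variable after the other, falling factorials by indicators. -/
theorem map_eq_pi_poissonMeasure {Ω ι : Type*} [MeasurableSpace Ω] {P : Measure Ω}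
    [IsProbabilityMeasure P] [Fintype ι] {K : ι → Ω → ℕ} (hK : ∀ i, Measurable (K i))
    (l : ι → ℝ≥0)
    (hint : ∀ a : ι → ℕ, Integrable (fun ω => ∏ i, ((K i ω).descFactorial (a i) : ℝ)) P)
    (hval : ∀ a : ι → ℕ, ∫ ω, ∏ i, ((K i ω).descFactorial (a i) : ℝ) ∂P = ∏ i, (l i : ℝ) ^ a i) :
    P.map (fun ω i => K i ω) = Measure.pi fun i => poissonMeasure (l i) := by
  classical
  have key : ∀ (m : ι → ℕ) (s : Finset ι) (a : ι → ℕ),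
      Integrable (fun ω => ∏ i, if i ∈ s then (if K i ω = m i then (1 : ℝ) else 0)
        else ((K i ω).descFactorial (a i) : ℝ)) P ∧
      ∫ ω, ∏ i, (if i ∈ s then (if K i ω = m i then (1 : ℝ) else 0)
        else ((K i ω).descFactorial (a i) : ℝ)) ∂P =
      ∏ i, if i ∈ s then Real.exp (-(l i)) * (l i : ℝ) ^ m i / (m i).factorial
        else (l i : ℝ) ^ a i := by
    intro m s
    induction s using Finset.induction_on with
    | empty => intro a; simpa using ⟨hint a, hval a⟩
    | insert j s hj ih =>
      intro a
      set H : Ω → ℝ := fun ω => ∏ i ∈ Finset.univ.erase j,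
        if i ∈ s then (if K i ω = m i then (1 : ℝ) else 0)
        else ((K i ω).descFactorial (a i) : ℝ) with hH
      set C : ℝ := ∏ i ∈ Finset.univ.erase j,
        if i ∈ s then Real.exp (-(l i)) * (l i : ℝ) ^ m i / (m i).factorial
        else (l i : ℝ) ^ a i with hC
      have hH0 : ∀ ω, 0 ≤ H ω := fun ω => Finset.prod_nonneg fun i _ => by
        split_ifs <;> positivity
      have hdesc : ∀ (b : ℕ) (ω : Ω), (∏ i, if i ∈ s then (if K i ω = m i then (1 : ℝ) else 0)
          else ((K i ω).descFactorial (Function.update a j b i) : ℝ)) =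
          ((K j ω).descFactorial b : ℝ) * H ω := fun b ω => by
        rw [← Finset.mul_prod_erase _ _ (Finset.mem_univ j), if_neg hj, Function.update_self]
        congr 1
        refine Finset.prod_congr rfl fun i hi => ?_
        rw [Function.update_of_ne (Finset.ne_of_mem_erase hi)]
      have hdescC : ∀ b : ℕ, (∏ i, if i ∈ s then Real.exp (-(l i)) * (l i : ℝ) ^ m i /
          (m i).factorial else (l i : ℝ) ^ (Function.update a j b i)) = C * (l j : ℝ) ^ b :=
        fun b => by
        rw [← Finset.mul_prod_erase _ _ (Finset.mem_univ j), if_neg hj, Function.update_self,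
          mul_comm]
        congr 1
        refine Finset.prod_congr rfl fun i hi => ?_
        rw [Function.update_of_ne (Finset.ne_of_mem_erase hi)]
      have hone := integral_ite_eq_of_descFactorial (P := P) (hK j) hH0 (C := C) (l := l j)
        (fun b => by simpa only [hdesc] using (ih (Function.update a j b)).1)
        (fun b => by simpa only [hdesc, hdescC] using (ih (Function.update a j b)).2) (m j)
      have hins : ∀ ω, (∏ i, if i ∈ insert j s then (if K i ω = m i then (1 : ℝ) else 0)
          else ((K i ω).descFactorial (a i) : ℝ)) = (if K j ω = m j then (1 : ℝ) else 0) * H ω :=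
        fun ω => by
        rw [← Finset.mul_prod_erase _ _ (Finset.mem_univ j), if_pos (Finset.mem_insert_self j s)]
        congr 1
        refine Finset.prod_congr rfl fun i hi => ?_
        simp only [Finset.mem_insert, Finset.ne_of_mem_erase hi, false_or]
      have hinsC : (∏ i, if i ∈ insert j s then Real.exp (-(l i)) * (l i : ℝ) ^ m i /
          (m i).factorial else (l i : ℝ) ^ (a i)) =
          C * (Real.exp (-(l j)) * (l j : ℝ) ^ m j / (m j).factorial) := by
        rw [← Finset.mul_prod_erase _ _ (Finset.mem_univ j), if_pos (Finset.mem_insert_self j s),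
          mul_comm]
        congr 1
        refine Finset.prod_congr rfl fun i hi => ?_
        simp only [Finset.mem_insert, Finset.ne_of_mem_erase hi, false_or]
      simp only [hins, hinsC]
      exact hone
  have hKm : Measurable fun ω i => K i ω := measurable_pi_lambda _ hK
  have : IsProbabilityMeasure (P.map fun ω i => K i ω) :=
    Measure.isProbabilityMeasure_map hKm.aemeasurable
  refine Measure.ext_of_singleton fun m => ?_
  have h := (key m Finset.univ 0).2
  simp only [Finset.mem_univ, if_true] at h
  have hind : ∀ ω, (∏ i, if K i ω = m i then (1 : ℝ) else 0) =
      ((fun ω i => K i ω) ⁻¹' {m}).indicator 1 ω := fun ω => by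
    rw [Finset.prod_boole]
    simp [indicator_apply, funext_iff]
  simp_rw [hind] at h
  rw [integral_indicator_one (hKm (measurableSet_singleton m))] at h
  rw [Measure.map_apply hKm (measurableSet_singleton m), Measure.pi_singleton,
    ← ofReal_measureReal, h, ENNReal.ofReal_prod_of_nonneg fun i _ => by positivity]
  exact Finset.prod_congr rfl fun i _ => (poissonMeasure_singleton _ _).symm

theorem iIndepFun_and_map_eq_poissonMeasure {Ω ι : Type*} [MeasurableSpace Ω] {P : Measure Ω}
    [IsProbabilityMeasure P] [Fintype ι] {K : ι → Ω → ℕ} (hK : ∀ i, Measurable (K i))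
    (l : ι → ℝ≥0) (h : P.map (fun ω i => K i ω) = Measure.pi fun i => poissonMeasure (l i)) :
    iIndepFun K P ∧ ∀ i, P.map (K i) = poissonMeasure (l i) := by
  have hmap : ∀ i, P.map (K i) = poissonMeasure (l i) := fun i => by
    rw [← (measurePreserving_eval (fun i => poissonMeasure (l i)) i).map_eq, ← h,
      Measure.map_map (measurable_pi_apply i) (measurable_pi_lambda _ hK)]
    rfl
  refine ⟨(iIndepFun_iff_map_fun_eq_pi_map fun i => (hK i).aemeasurable).2 ?_, hmap⟩
  simp_rw [hmap, h]

/-! ### The Poisson law -/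

section Poisson

variable {X Ω : Type*} [MetricSpace X] [MeasurableSpace X] [BorelSpace X] [MeasurableSpace Ω]
  {μ : Measure X} {T : X ≃ᵐ X} {P : Measure Ω} {S : Ω ≃ᵐ Ω} {N : Ω → Measure X}

theorem ae_eq_natCast_pointCount (hN : IsTPointProcess μ T P S N) {A : Set X}
    (h : ∀ᵐ ω ∂P, N ω A < ∞) :
    (fun ω => N ω A) =ᵐ[P] fun ω => ((pointCount N A ω : ℕ) : ℝ≥0∞) := by
  filter_upwards [h] with ω hω
  obtain ⟨s, -, -, -, hs⟩ := hN.pointProcess.exists_points_count ω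
  exact (hs _ hω).2.2

/-- With zero intensity the process has no points at all, so that also sets of infinite measure
contain none. -/
theorem HasFactorialMoments.ae_eq_zero [Nonempty X] {c : ℕ → ℝ≥0}
    (h : HasFactorialMoments μ P N c) (hc : c 1 = 0) (hμ : BoundedlyFinite μ)
    (hN : IsTPointProcess μ T P S N) (hmom : HasAllMoments μ P N) : ∀ᵐ ω ∂P, N ω = 0 := by
  obtain ⟨x⟩ := ‹Nonempty X›
  have hball : ∀ r : ℕ, ∀ᵐ ω ∂P, N ω (Metric.closedBall x r) = 0 := fun r => by
    have hm : MeasurableSet (Metric.closedBall x (r : ℝ)) :=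
      Metric.isClosed_closedBall.measurableSet
    have hfin : μ (Metric.closedBall x (r : ℝ)) < ∞ := hμ _ Metric.isBounded_closedBall
    have h1 := h Unit (fun _ => 1) (fun _ => Metric.closedBall x (r : ℝ)) (fun _ => hm)
      (fun _ => hfin) (fun i j hij => absurd (Subsingleton.elim i j) hij)
    simp only [Nat.descFactorial_one, Finset.univ_unique, Finset.prod_singleton,
      Finset.sum_singleton, hc, ENNReal.coe_zero, zero_mul] at h1
    have hmeas : Measurable fun ω => ((pointCount N (Metric.closedBall x (r : ℝ)) ω : ℕ) : ℝ≥0∞) :=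
      (Measurable.of_discrete (f := fun k : ℕ => (k : ℝ≥0∞))).comp
        (measurable_pointCount hN.pointProcess.measurable hm)
    rw [lintegral_eq_zero_iff hmeas] at h1
    filter_upwards [h1, ae_eq_natCast_pointCount hN (hN.ae_lt_top hmom hm hfin)] with ω h2 h3
    rw [h3]
    exact h2
  filter_upwards [ae_all_iff.2 hball] with ω hω
  rw [← Measure.measure_univ_eq_zero, ← Metric.iUnion_closedBall_nat x]
  exact measure_iUnion_null hω

/-- A process whose factorial moments have the constants `αⁿ` is a Poisson process. -/
theorem HasFactorialMoments.isPoissonProcess [Nonempty X] [IsProbabilityMeasure P] {c : ℕ → ℝ≥0}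
    {α : ℝ≥0} (h : HasFactorialMoments μ P N c) (hc : ∀ n, c n = α ^ n) (hμ : BoundedlyFinite μ)
    (hN : IsTPointProcess μ T P S N) (hmom : HasAllMoments μ P N) :
    IsPoissonProcess (α • μ) P N := by
  refine ⟨hN.pointProcess, fun k A hA hfin hdisj => ?_⟩
  have hNm := hN.pointProcess.measurable
  have hKm : ∀ i, Measurable (pointCount N (A i)) := fun i => measurable_pointCount hNm (hA i)
  suffices hmain : (∀ i, ∀ᵐ ω ∂P, N ω (A i) < ∞) ∧
      P.map (fun ω i => pointCount N (A i) ω) =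
        Measure.pi fun i => poissonMeasure ((α • μ) (A i)).toNNReal by
    obtain ⟨hlt, hlaw⟩ := hmain
    obtain ⟨hind, hmap⟩ := iIndepFun_and_map_eq_poissonMeasure hKm _ hlaw
    have heq := fun i => ae_eq_natCast_pointCount hN (hlt i)
    refine ⟨iIndepFun.congr (fun i => (heq i).symm)
      (hind.comp (fun _ (k : ℕ) => (k : ℝ≥0∞)) fun _ => Measurable.of_discrete), fun i => ?_⟩
    rw [Measure.map_congr (heq i), ← hmap i, Measure.map_map Measurable.of_discrete (hKm i)]
    rfl
  have hnn : ∀ i, (((α • μ) (A i)).toNNReal : ℝ) = α * (μ (A i)).toReal := fun i => by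
    rw [Measure.smul_apply, ENNReal.coe_toNNReal_eq_toReal, ENNReal.smul_def, smul_eq_mul,
      ENNReal.toReal_mul, ENNReal.coe_toReal]
  rcases eq_or_ne α 0 with rfl | hα
  · have hzero := h.ae_eq_zero (by simpa using hc 1) hμ hN hmom
    have hK0 : ∀ᵐ ω ∂P, ∀ i, pointCount N (A i) ω = 0 := by
      filter_upwards [hzero] with ω hω i
      simp [pointCount, hω]
    refine ⟨fun i => by filter_upwards [hzero] with ω hω; simp [hω], ?_⟩
    have hprod : ∀ a : Fin k → ℕ, (fun ω => ∏ i, ((pointCount N (A i) ω).descFactorial (a i) : ℝ))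
        =ᵐ[P] fun _ => ∏ i, (((0 : ℝ≥0) • μ) (A i)).toNNReal ^ a i := fun a => by
      filter_upwards [hK0] with ω hω
      push_cast
      refine Finset.prod_congr rfl fun i _ => ?_
      rw [hω i]
      rcases Nat.eq_zero_or_pos (a i) with h0 | h0
      · simp [h0]
      · simp [Nat.descFactorial_of_lt h0, h0.ne']
    refine map_eq_pi_poissonMeasure hKm _ (fun a => ?_) fun a => ?_
    · exact (integrable_const _).congr (hprod a).symm
    · rw [integral_congr_ae (hprod a)]
      simp
  · have hfin' : ∀ i, μ (A i) < ∞ := fun i => by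
      have h1 := hfin i
      rw [Measure.smul_apply, ENNReal.smul_def, smul_eq_mul] at h1
      exact (ENNReal.lt_top_of_mul_ne_top_right h1.ne (by simpa using hα))
    refine ⟨fun i => hN.ae_lt_top hmom (hA i) (hfin' i),
      map_eq_pi_poissonMeasure hKm _ (fun a => (h.integral_prod hNm a A hA hfin' hdisj).1)
        fun a => ?_⟩
    rw [(h.integral_prod hNm a A hA hfin' hdisj).2, hc, ← Finset.prod_pow_eq_pow_sum]
    simp only [hnn, mul_pow, Finset.prod_mul_distrib, NNReal.coe_prod, NNReal.coe_pow]

end Poisson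

theorem mainTheorem2 {X : Type*} [MetricSpace X] [CompleteSpace X]
    [TopologicalSpace.SeparableSpace X] [MeasurableSpace X] [BorelSpace X]
    (μ : Measure X) (T : X ≃ᵐ X)
    (hμ_bdd : BoundedlyFinite μ) (hμ_inf : μ univ = ∞)
    (hT_cons : Conservative T μ) (hT_erg : Ergodic T μ)
    (hP1 : PropertyP1 μ T) (hP2 : PropertyP2 μ T)
    {Ω : Type*} [MeasurableSpace Ω] (P : Measure Ω) [IsProbabilityMeasure P]
    (S : Ω ≃ᵐ Ω) (hS_erg : Ergodic S P)
    (N : Ω → Measure X) (hN : IsTPointProcess μ T P S N)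
    (hN_free : IsFreeProcess P S N) (hN_moments : HasAllMoments μ P N) :
    ∃ α : ℝ≥0, IsPoissonProcess (α • μ) P N := by
  have h0 : μ ≠ 0 := by
    rintro rfl
    simp at hμ_inf
  have : SecondCountableTopology X := UniformSpace.secondCountable_of_separable X
  have : Nonempty X := by
    by_contra hX
    rw [not_nonempty_iff] at hX
    exact h0 (Measure.eq_zero_of_isEmpty μ)
  have := nullSingletonClass_of_conservative_ergodic hμ_bdd hμ_inf hT_cons hT_erg
  obtain ⟨c, hc0, hc⟩ :=
    exists_lintegral_prod_descFactorial hμ_bdd h0 hP2 hN hN_free hN_moments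
  obtain ⟨α, hα⟩ := hc.exists_eq_pow hc0 hμ_bdd hμ_inf hT_erg.toMeasurePreserving hS_erg hN
    hN_moments
  exact ⟨α, hc.isPoissonProcess hα hμ_bdd hN hN_moments⟩
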